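/- Let $\kappa$ be an uncountable cardinal. Logics. $\mathbb{L}^2_{\lambda,\kappa}$ is second-order infinitary logic with the standard semantics (on nonempty structures): besides the atomic formulas (equality, the relation symbols, and membership of an $n$-tuple of individuals in a subset of the $n$-th power of the universe) one may form negations, conjunctions and disjunctions of fewer than $\lambda$ formulas, and quantify simultaneously over fewer than $\kappa$ variables, each ranging over individuals or over all subsets of a finite power of the universe. Its languages have function and relation symbols of arity $<\kappa$, whose inputs and outputs may be individuals or subsets of finite powers of the universe. $\mathbb{L}^2=\mathbb{L}^2_{\omega,\omega}$, and $\mathbb{L}_{\kappa,\omega}$ is the strictly first-order part of $\mathbb{L}^2_{\kappa,\omega}$. A formula of $\mathbb{L}^2\cup\mathbb{L}_{\kappa,\omega}$ (over a language with finitary symbols) is one that belongs to $\mathbb{L}^2$ or to $\mathbb{L}_{\kappa,\omega}$. For a logic $\mathcal{L}$, $\kappa$ is weakly compact-for-$\mathcal{L}$ if every theory of size $\kappa$ in $\mathcal{L}$, all of whose subsets of size $<\kappa$ are satisfiable, is satisfiable. Let $\ell^2_\kappa$ be the Löwenheim–Skolem number of $\mathbb{L}^2_{\kappa,\kappa}$: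 the least cardinal $\mu$ such that every satisfiable sentence of $\mathbb{L}^2_{\kappa,\kappa}$ has a model of size $<\mu$. Consider the conditions: 1. $\kappa$ is weakly compact-for-$\mathbb{L}^2\cup\mathbb{L}_{\kappa,\omega}$. 2. $\kappa$ is weakly compact-for-$\mathbb{L}^2_{\kappa,\kappa}$. 3. For every set $\mathcal{M}$ of size $\kappa$ with $\kappa+1\subseteq\mathcal{M}\subseteq V_{\ell^2_\kappa}$ there are an ordinal $\beta$ and a map $j:\mathcal{M}\to V_\beta$ with critical point $\kappa$ (that is, $\kappa$ is the least ordinal in $\mathcal{M}$ moved by $j$) which is partial elementary from $V_{\ell^2_\kappa}$ to $V_\beta$: for every first-order formula $\varphi$ in the language $\{\in\}$ and every finite tuple $\bar a$ from $\mathcal{M}$, $(V_{\ell^2_\kappa},\in)\models\varphi(\bar a)$ if and only if $(V_\beta,\in)\models\varphi(j(\bar a))$. Then (1) and (2) are equivalent, and if $\kappa<\ell^2_\kappa$ (that is, if $\kappa\in V_{\ell^2_\kappa}$, so that sets $\mathcal{M}$ as in (3) exist), then (1), (2) and (3) are equivalent. -/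

import Mathlib

universe u

open Cardinal

/-! Throughout, the set-theoretic universe is `ZFSet.{u}`; correspondingly languages, index sets and
models are types in `Type u`, and cardinals and ordinals are those of universe `u`. -/

namespace SecondOrder

/-! ### Syntax of second-order infinitary logic -/

/-- The kinds of objects of second-order logic: individuals, and, for every `n`, the subsets of the
`n`-th cartesian power of the universe. -/
inductive Kind : Type u
  | ind : Kind
  | set (n : ℕ) : Kind

/-- The objects of a given kind over the universe `M` (standard semantics: all subsets). -/
def Kind.Obj (M : Type u) : Kind.{u} → Type u
  | .ind => M
  | .set n => Set (Fin n → M)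

/-- A second-order language: function and relation symbols of possibly infinite arity, whose
inputs and outputs may be individuals or second-order objects. Constants are the function symbols
of empty arity. -/
structure Language where
  /-- function symbols -/
  Fn : Type u
  /-- the set of argument places of a function symbol -/
  FnArity : Fn → Type u
  fnIn : (f : Fn) → FnArity f → Kind.{u}
  fnOut : Fn → Kind.{u}
  /-- relation symbols -/
  Rl : Type u
  /-- the set of argument places of a relation symbol -/
  RlArity : Rl → Type u
  rlIn : (r : Rl) → RlArity r → Kind.{u}

/-- All function and relation symbols have arity `< κ`. -/
def Language.ArityLT (L : Language.{u}) (κ : Cardinal.{u}) : Prop :=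
  (∀ f, #(L.FnArity f) < κ) ∧ ∀ r, #(L.RlArity r) < κ

/-- Terms of a given kind, with free variables `x : X`, the variable `x` being of kind `Γ x`. -/
inductive Term (L : Language.{u}) {X : Type u} (Γ : X → Kind.{u}) : Kind.{u} → Type u
  | var (x : X) : Term L Γ (Γ x)
  | app (f : L.Fn) (ts : (i : L.FnArity f) → Term L Γ (L.fnIn f i)) : Term L Γ (L.fnOut f)

/-- Second-order infinitary formulas with free variables `x : X` of kind `Γ x`. Conjunctions and
blocks of quantified (first- and second-order) variables may be indexed by arbitrary sets; the size
restrictions are imposed by `Formula.InL2` below. Disjunctions and existential quantifiers are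
obtained by negation. -/
inductive Formula (L : Language.{u}) : {X : Type u} → (X → Kind.{u}) → Type (u + 1)
  | eq {X : Type u} {Γ : X → Kind.{u}} {k : Kind.{u}} (t s : Term L Γ k) : Formula L Γ
  | mem {X : Type u} {Γ : X → Kind.{u}} {n : ℕ} (ts : Fin n → Term L Γ Kind.ind)
      (S : Term L Γ (Kind.set n)) : Formula L Γ
  | rel {X : Type u} {Γ : X → Kind.{u}} (r : L.Rl)
      (ts : (i : L.RlArity r) → Term L Γ (L.rlIn r i)) : Formula L Γ
  | neg {X : Type u} {Γ : X → Kind.{u}} (φ : Formula L Γ) : Formula L Γ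
  | conj {X : Type u} {Γ : X → Kind.{u}} {I : Type u} (φ : I → Formula L Γ) : Formula L Γ
  | all {X : Type u} {Γ : X → Kind.{u}} {Y : Type u} (Δ : Y → Kind.{u})
      (φ : Formula L (Sum.elim Γ Δ)) : Formula L Γ

/-- Sentences: formulas without free variables. -/
abbrev Sentence (L : Language.{u}) : Type (u + 1) :=
  Formula L (PEmpty.elim : PEmpty.{u + 1} → Kind.{u})

/-! ### Semantics -/

/-- An interpretation of the language `L` on the universe `M`. -/
structure Interp (L : Language.{u}) (M : Type u) where
  fn : (f : L.Fn) → ((i : L.FnArity f) → (L.fnIn f i).Obj M) → (L.fnOut f).Obj M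
  rl : (r : L.Rl) → ((i : L.RlArity r) → (L.rlIn r i).Obj M) → Prop

/-- The value of a term under an assignment. -/
def Term.val {L : Language.{u}} {M : Type u} (A : Interp L M) {X : Type u} {Γ : X → Kind.{u}}
    (v : (x : X) → (Γ x).Obj M) : {k : Kind.{u}} → Term L Γ k → k.Obj M
  | _, .var x => v x
  | _, .app f ts => A.fn f fun i => (ts i).val A v

/-- Extending an assignment by values for a block of new variables. -/
def extend {M : Type u} {X Y : Type u} {Γ : X → Kind.{u}} {Δ : Y → Kind.{u}}
    (v : (x : X) → (Γ x).Obj M) (w : (y : Y) → (Δ y).Obj M) :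
    (z : X ⊕ Y) → (Sum.elim Γ Δ z).Obj M
  | .inl x => v x
  | .inr y => w y

/-- Truth of a formula under an assignment, with the standard interpretation of second-order
quantifiers. -/
def Formula.Holds {L : Language.{u}} {M : Type u} (A : Interp L M) :
    {X : Type u} → {Γ : X → Kind.{u}} → Formula L Γ → ((x : X) → (Γ x).Obj M) → Prop
  | _, _, .eq t s, v => t.val A v = s.val A v
  | _, _, .mem ts S, v =>
      let R : Set (Fin _ → M) := S.val A v
      (fun i => (ts i).val A v) ∈ R
  | _, _, .rel r ts, v => A.rl r fun i => (ts i).val A v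
  | _, _, .neg φ, v => ¬ φ.Holds A v
  | _, _, .conj φ, v => ∀ i, (φ i).Holds A v
  | _, _, .all Δ φ, v => ∀ w : (y : _) → (Δ y).Obj M, φ.Holds A (extend v w)

/-- Truth of a sentence in a structure. -/
def Sentence.True {L : Language.{u}} {M : Type u} (A : Interp L M) (φ : Sentence L) : Prop :=
  φ.Holds A fun x => PEmpty.elim x

/-- A theory is satisfiable if it has a (nonempty) model. -/
def Satisfiable {L : Language.{u}} (T : Set (Sentence L)) : Prop :=
  ∃ (M : Type u) (_ : Nonempty M) (A : Interp L M), ∀ φ ∈ T, Sentence.True A φ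

/-- A theory is `<κ`-satisfiable if all its subsets of size `< κ` are satisfiable. -/
def SatisfiableLT (κ : Cardinal.{u}) {L : Language.{u}} (T : Set (Sentence L)) : Prop :=
  ∀ T₀ ⊆ T, #T₀ < lift.{u + 1} κ → Satisfiable T₀

/-! ### The logics -/

/-- The formulas of `𝕃²_{lam,κ}`: conjunctions of `< lam` formulas and quantification over `< κ`
(first- and second-order) variables at once. -/
def Formula.InL2 (lam κ : Cardinal.{u}) {L : Language.{u}} :
    {X : Type u} → {Γ : X → Kind.{u}} → Formula L Γ → Prop
  | _, _, .eq _ _ => True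
  | _, _, .mem _ _ => True
  | _, _, .rel _ _ => True
  | _, _, .neg φ => φ.InL2 lam κ
  | _, _, .conj (I := I) φ => #I < lam ∧ ∀ i, (φ i).InL2 lam κ
  | _, _, .all (Y := Y) _ φ => #Y < κ ∧ φ.InL2 lam κ

/-- Strictly first-order terms: only individual variables and symbols taking individuals to
individuals occur. -/
def Term.FirstOrder {L : Language.{u}} {X : Type u} {Γ : X → Kind.{u}} :
    {k : Kind.{u}} → Term L Γ k → Prop
  | _, .var x => Γ x = Kind.ind
  | _, .app f ts => L.fnOut f = Kind.ind ∧ ∀ i, L.fnIn f i = Kind.ind ∧ (ts i).FirstOrder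

/-- Strictly first-order formulas: no second-order variable, quantifier, symbol or membership. -/
def Formula.FirstOrder {L : Language.{u}} :
    {X : Type u} → {Γ : X → Kind.{u}} → Formula L Γ → Prop
  | _, _, .eq t s => t.FirstOrder ∧ s.FirstOrder
  | _, _, .mem _ _ => False
  | _, _, .rel r ts => ∀ i, L.rlIn r i = Kind.ind ∧ (ts i).FirstOrder
  | _, _, .neg φ => φ.FirstOrder
  | _, _, .conj φ => ∀ i, (φ i).FirstOrder
  | _, _, .all Δ φ => (∀ y, Δ y = Kind.ind) ∧ φ.FirstOrder

/-- The formulas of `𝕃² ∪ 𝕃_{κ,ω}`, where `𝕃² = 𝕃²_{ω,ω}`. -/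
def Formula.InL2UnionL (κ : Cardinal.{u}) {L : Language.{u}} {X : Type u} {Γ : X → Kind.{u}}
    (φ : Formula L Γ) : Prop :=
  φ.InL2 ℵ₀ ℵ₀ ∨ (φ.InL2 κ ℵ₀ ∧ φ.FirstOrder)

/-- `κ` is weakly compact-for-`𝕃² ∪ 𝕃_{κ,ω}`: every `<κ`-satisfiable theory of size `κ` of this logic
(in a finitary language) is satisfiable. -/
def WeaklyCompactForL2UnionL (κ : Cardinal.{u}) : Prop :=
  ∀ (L : Language.{u}), L.ArityLT ℵ₀ → ∀ T : Set (Sentence L), (∀ φ ∈ T, φ.InL2UnionL κ) →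
    #T = lift.{u + 1} κ → SatisfiableLT κ T → Satisfiable T

/-- `κ` is weakly compact-for-`𝕃²_{κ,κ}`: every `<κ`-satisfiable theory of size `κ` of this logic
(in a language with symbols of arity `< κ`) is satisfiable. -/
def WeaklyCompactForL2 (κ : Cardinal.{u}) : Prop :=
  ∀ (L : Language.{u}), L.ArityLT κ → ∀ T : Set (Sentence L), (∀ φ ∈ T, φ.InL2 κ κ) →
    #T = lift.{u + 1} κ → SatisfiableLT κ T → Satisfiable T

/-- The Löwenheim–Skolem number `ℓ²_κ` of `𝕃²_{κ,κ}`: the least cardinal `μ` such that every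
satisfiable sentence of `𝕃²_{κ,κ}` has a model of size `< μ`. -/
noncomputable def lsNumber (κ : Cardinal.{u}) : Cardinal.{u} :=
  sInf {μ | ∀ (L : Language.{u}), L.ArityLT κ → ∀ φ : Sentence L, φ.InL2 κ κ →
    Satisfiable {φ} →
    ∃ (M : Type u) (_ : Nonempty M) (A : Interp L M), #M < μ ∧ Sentence.True A φ}

/-! ### Partial elementary embeddings between levels of the cumulative hierarchy -/

/-- The only symbol of the first-order language of set theory, a binary relation symbol. -/
inductive MemSymb : ℕ → Type
  | mem : MemSymb 2

/-- The first-order language of set theory. -/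
def setLang : FirstOrder.Language := ⟨fun _ => Empty, MemSymb⟩

/-- The rank-initial segment `V_α`, as a type. -/
abbrev VLevel (α : Ordinal.{u}) : Type (u + 1) := {x : ZFSet.{u} // x ∈ ZFSet.vonNeumann α}

/-- The structure `(V_α, ∈)`. -/
instance (α : Ordinal.{u}) : setLang.Structure (VLevel α) where
  funMap := fun f => Empty.elim f
  RelMap := fun r => match r with
    | MemSymb.mem => fun x => (x 0 : ZFSet.{u}) ∈ (x 1 : ZFSet.{u})

/-- `j`, a function from `D ⊆ V_α` to `V_β`, is a partial elementary embedding from `V_α` to `V_β`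
with domain `D`. -/
def IsPartialElementary {α β : Ordinal.{u}} (D : Set (VLevel α)) (j : D → VLevel β) : Prop :=
  ∀ (n : ℕ) (φ : setLang.Formula (Fin n)) (x : Fin n → D),
    φ.Realize (fun i => (x i : VLevel α)) ↔ φ.Realize (fun i => j (x i))

/-- `γ` is the critical point of the partial map `j`: the least ordinal in its domain that is moved
by `j`. -/
def IsCrit {α β : Ordinal.{u}} (D : Set (VLevel α)) (j : D → VLevel β) (γ : Ordinal.{u}) : Prop :=
  IsLeast {δ : Ordinal.{u} | ∃ x : D, (x : ZFSet.{u}) = δ.toZFSet ∧ (j x : ZFSet.{u}) ≠ δ.toZFSet} γ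

/-- For every `D` of size `κ` with `κ + 1 ⊆ D ⊆ V_{ℓ²_κ}` there is a partial elementary embedding
from `V_{ℓ²_κ}` to some `V_β` with domain `D` and critical point `κ`. -/
def PartialEmbeddingProperty (κ : Cardinal.{u}) : Prop :=
  ∀ D : Set (VLevel (lsNumber κ).ord),
    (∀ δ ≤ κ.ord, ∃ x ∈ D, (x : ZFSet.{u}) = δ.toZFSet) → #D = lift.{u + 1} κ →
    ∃ (β : Ordinal.{u}) (j : D → VLevel β), IsPartialElementary D j ∧ IsCrit D j κ.ord

end SecondOrder

namespace SecondOrder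

open Order ZFSet

/-! ### Properties of sets uniformly definable over the limit levels of the hierarchy -/

/-! Everything passes through `EmbeddingPropertyAt κ θ`, condition (3) with an arbitrary level V_θ
in place of V_{ℓ²_κ}. Condition (2) gives (1) because the union logic is part of 𝕃²_{κ,κ}.

From (1) to embeddings (`embeddingPropertyAt_of_weaklyCompact`, any θ). Take constants for the
elements of D and one new constant d. The theory says that the model is some (V_β, ∈), which three
𝕃² sentences express (`exists_level`, `true_of_level`). It also contains the first-order diagram of
D in V_θ, sentences of 𝕃_{κ,ω} bounding the elements of each ordinal i < κ, and "d ∈ κ" together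
with "d ≠ i" for all i < κ. Fewer than κ of these sentences hold in V_θ with d a suitable ordinal
below κ. A model of all of them is a V_β, and sending each element of D to the value of its constant
gives j. The bounds force j(i) = i for i < κ, and d puts a new element into j(κ).

From embeddings to satisfiability (`satisfiable_of_embeddingPropertyAt`, levels V_μ with μ > κ a
cardinal). Enumerate the theory as φ_i, i < κ. Its syntax is coded by a table of relations on κ, and
a structure by sets M, O, V, S: universe, objects, values of terms, truth of formulas. "M, O, V, S
model the first α sentences" is first-order over V_β, uniformly in limit β (`UD.models`): such a V_β
contains all subsets of powers of M and all assignments, so second-order truth is computed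
correctly. If initial segments of the theory have models of size < μ, then V_μ satisfies "for each α
∈ κ there are such M, O, V, S" (`models_of_holds`). Apply j and choose α in j(κ) but not in κ. The
resulting sets obey the clauses of the image table, which agrees with the original one at indices
below κ since these are fixed. As α contains every i < κ, decoding yields a model of the whole
theory (`mem_sat_iff`).

For (1) ⇒ (2), μ is chosen above the sizes of models of all initial segments. For (3) ⇒ (2), μ =
ℓ²_κ works: each initial segment is, as a conjunction, a single sentence of 𝕃²_{κ,κ}. (2) ⇒ (3) is
(2) ⇒ (1) followed by the first construction. -/

theorem mem_level_of_mem {β : Ordinal.{u}} {x y : ZFSet.{u}} (h : x ∈ y) (hy : y ∈ vonNeumann β) :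
    x ∈ vonNeumann β :=
  isTransitive_vonNeumann β y hy h

theorem pairset_mem_level {β : Ordinal.{u}} (hβ : IsSuccLimit β) {x y : ZFSet.{u}}
    (hx : x ∈ vonNeumann β) (hy : y ∈ vonNeumann β) : ({x, y} : ZFSet) ∈ vonNeumann β := by
  rw [mem_vonNeumann] at *
  rw [rank_pair]
  exact max_lt (hβ.succ_lt hx) (hβ.succ_lt hy)

theorem pair_mem_level {β : Ordinal.{u}} (hβ : IsSuccLimit β) {x y : ZFSet.{u}}
    (hx : x ∈ vonNeumann β) (hy : y ∈ vonNeumann β) : pair x y ∈ vonNeumann β := by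
  have h := pairset_mem_level hβ hx hx
  rw [pair_eq_singleton] at h
  exact pairset_mem_level hβ h (pairset_mem_level hβ hx hy)

theorem powerset_mem_level {β : Ordinal.{u}} (hβ : IsSuccLimit β) {x : ZFSet.{u}}
    (hx : x ∈ vonNeumann β) : powerset x ∈ vonNeumann β := by
  rw [mem_vonNeumann] at *
  rw [rank_powerset]
  exact hβ.succ_lt hx

theorem union_mem_level {β : Ordinal.{u}} {x y : ZFSet.{u}}
    (hx : x ∈ vonNeumann β) (hy : y ∈ vonNeumann β) : x ∪ y ∈ vonNeumann β := by
  rw [mem_vonNeumann] at *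
  rw [rank_union]
  exact max_lt hx hy

theorem prod_mem_level {β : Ordinal.{u}} (hβ : IsSuccLimit β) {x y : ZFSet.{u}}
    (hx : x ∈ vonNeumann β) (hy : y ∈ vonNeumann β) : prod x y ∈ vonNeumann β :=
  mem_vonNeumann_of_subset (y := powerset (powerset (x ∪ y)))
    (fun z h => by
      obtain ⟨a, ha, b, hb, rfl⟩ := ZFSet.mem_prod.1 h
      grind [mem_pair, mem_powerset, mem_singleton, mem_union, pair, subset_def])
    (powerset_mem_level hβ (powerset_mem_level hβ (union_mem_level hx hy)))

theorem isFunc_mem_level {β : Ordinal.{u}} (hβ : IsSuccLimit β) {x y f : ZFSet.{u}}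
    (hx : x ∈ vonNeumann β) (hy : y ∈ vonNeumann β) (h : IsFunc x y f) : f ∈ vonNeumann β :=
  mem_vonNeumann_of_subset h.1 (prod_mem_level hβ hx hy)

/-- The membership symbol. -/
def memRel : setLang.Relations 2 := MemSymb.mem

/-- The atomic formula `x ∈ y`. -/
def memFormula {X : Type} (x y : X) : setLang.Formula X :=
  memRel.formula₂ (FirstOrder.Language.Term.var x) (FirstOrder.Language.Term.var y)

theorem realize_memFormula {X : Type} {β : Ordinal.{u}} (x y : X) (v : X → VLevel β) :
    (memFormula x y).Realize v ↔ (v x : ZFSet.{u}) ∈ (v y : ZFSet.{u}) := by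
  rw [memFormula, FirstOrder.Language.Formula.realize_rel₂]
  exact Iff.rfl

/-- `P` is defined, in every level `V_β` with `β` a limit, by one and the same first-order formula
of set theory. -/
def UD {X : Type} (P : Ordinal.{u} → (X → ZFSet.{u}) → Prop) : Prop :=
  ∃ φ : setLang.Formula X, ∀ β : Ordinal.{u}, IsSuccLimit β → ∀ v : X → VLevel β,
    φ.Realize v ↔ P β fun x => (v x : ZFSet.{u})

namespace UD

variable {X : Type} {P Q : Ordinal.{u} → (X → ZFSet.{u}) → Prop}

/-- Equivalence is needed only for limit levels and parameters inside the level, so an absolute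
reformulation with bounded quantifiers may replace a notion that quantifies over all sets. -/
theorem congr (hP : UD P) (h : ∀ β, IsSuccLimit β → ∀ w : X → ZFSet.{u},
    (∀ x, w x ∈ vonNeumann β) → (P β w ↔ Q β w)) : UD Q := by
  obtain ⟨φ, hφ⟩ := hP
  exact ⟨φ, fun β hβ v => (hφ β hβ v).trans (h β hβ _ fun x => (v x).2)⟩

theorem mem (x y : X) : UD fun _ w => w x ∈ w y :=
  ⟨memFormula x y, fun _ _ v => realize_memFormula x y v⟩

theorem eq (x y : X) : UD fun _ w => w x = w y :=
  ⟨FirstOrder.Language.Term.equal (FirstOrder.Language.Term.var x)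
    (FirstOrder.Language.Term.var y), fun β _ v => by
      rw [FirstOrder.Language.Formula.realize_equal]; exact Subtype.ext_iff⟩

theorem not (hP : UD P) : UD fun β w => ¬ P β w := by
  obtain ⟨φ, hφ⟩ := hP
  exact ⟨φ.not, fun β hβ v => by rw [FirstOrder.Language.Formula.realize_not, hφ β hβ]⟩

theorem imp (hP : UD P) (hQ : UD Q) : UD fun β w => P β w → Q β w := by
  obtain ⟨φ, hφ⟩ := hP
  obtain ⟨ψ, hψ⟩ := hQ
  exact ⟨φ.imp ψ, fun β hβ v => by
    rw [FirstOrder.Language.Formula.realize_imp, hφ β hβ, hψ β hβ]⟩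

theorem and (hP : UD P) (hQ : UD Q) : UD fun β w => P β w ∧ Q β w :=
  (hP.imp hQ.not).not.congr fun _ _ _ _ => by tauto

theorem or (hP : UD P) (hQ : UD Q) : UD fun β w => P β w ∨ Q β w :=
  (hP.not.imp hQ).congr fun _ _ _ _ => by tauto

theorem iff (hP : UD P) (hQ : UD Q) : UD fun β w => P β w ↔ Q β w :=
  ((hP.imp hQ).and (hQ.imp hP)).congr fun _ _ _ _ => by tauto

variable {R S : Ordinal.{u} → (X → ZFSet.{u}) → ZFSet.{u} → Prop}

theorem all (h : UD fun β (w : Option X → ZFSet.{u}) => R β (fun x => w (some x)) (w none)) :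
    UD fun β w => ∀ a ∈ vonNeumann β, R β w a := by
  obtain ⟨φ, hφ⟩ := h
  refine ⟨(φ.relabel (fun o : Option X => o.elim (Sum.inr ()) Sum.inl :
    Option X → X ⊕ Unit)).iAlls Unit, fun β hβ v => ?_⟩
  rw [FirstOrder.Language.Formula.realize_iAlls]
  simp only [FirstOrder.Language.Formula.realize_relabel]
  constructor
  · intro h a ha
    exact (hφ β hβ _).1 (h fun _ => ⟨a, ha⟩)
  · intro h i
    exact (hφ β hβ _).2 (h (i ()).1 (i ()).2)

theorem ex (h : UD fun β (w : Option X → ZFSet.{u}) => R β (fun x => w (some x)) (w none)) :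
    UD fun β w => ∃ a ∈ vonNeumann β, R β w a :=
  (UD.all (R := fun β w a => ¬ R β w a) h.not).not.congr fun _ _ _ _ => by push Not; rfl

/-- If the guard forces its witnesses into V_β, a quantifier over the whole universe is the same as
one over V_β. All quantifiers over functions, pairs and sets of tuples are absorbed in this way. -/
theorem all_of (hS : ∀ β, IsSuccLimit β → ∀ w : X → ZFSet.{u}, (∀ x, w x ∈ vonNeumann β) →
      ∀ a, S β w a → a ∈ vonNeumann β)
    (h' : UD fun β (w : Option X → ZFSet.{u}) => S β (fun x => w (some x)) (w none))
    (h : UD fun β (w : Option X → ZFSet.{u}) => R β (fun x => w (some x)) (w none)) :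
    UD fun β w => ∀ a, S β w a → R β w a :=
  (UD.all (R := fun β w a => S β w a → R β w a) (h'.imp h)).congr fun β hβ w hw =>
    ⟨fun h a ha => h a (hS β hβ w hw a ha) ha, fun h a _ ha => h a ha⟩

theorem ex_of (hS : ∀ β, IsSuccLimit β → ∀ w : X → ZFSet.{u}, (∀ x, w x ∈ vonNeumann β) →
      ∀ a, S β w a → a ∈ vonNeumann β)
    (h' : UD fun β (w : Option X → ZFSet.{u}) => S β (fun x => w (some x)) (w none))
    (h : UD fun β (w : Option X → ZFSet.{u}) => R β (fun x => w (some x)) (w none)) :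
    UD fun β w => ∃ a, S β w a ∧ R β w a :=
  (UD.ex (R := fun β w a => S β w a ∧ R β w a) (h'.and h)).congr fun β hβ w hw =>
    ⟨fun ⟨a, _, h⟩ => ⟨a, h⟩, fun ⟨a, h⟩ => ⟨a, hS β hβ w hw a h.1, h⟩⟩

theorem ball (y : X)
    (h : UD fun β (w : Option X → ZFSet.{u}) => R β (fun x => w (some x)) (w none)) :
    UD fun β w => ∀ a ∈ w y, R β w a :=
  all_of (S := fun _ w a => a ∈ w y) (fun _ _ _ hw _ ha => mem_level_of_mem ha (hw y))
    (mem none (some y)) h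

theorem bex (y : X)
    (h : UD fun β (w : Option X → ZFSet.{u}) => R β (fun x => w (some x)) (w none)) :
    UD fun β w => ∃ a ∈ w y, R β w a :=
  ex_of (S := fun _ w a => a ∈ w y) (fun _ _ _ hw _ ha => mem_level_of_mem ha (hw y))
    (mem none (some y)) h

theorem eq_pairset (x y z : X) : UD fun _ w => w z = ({w x, w y} : ZFSet) := by
  refine UD.congr (P := fun _ w => (w x ∈ w z ∧ w y ∈ w z) ∧ ∀ a ∈ w z, a = w x ∨ a = w y)
    (((mem _ _).and (mem _ _)).and (ball _ ((eq _ _).or (eq _ _)))) fun β _ w _ => ?_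
  rw [ZFSet.ext_iff]
  constructor
  · rintro ⟨⟨h1, h2⟩, h3⟩ a
    simp only [ZFSet.mem_pair]
    exact ⟨h3 a, by rintro (rfl | rfl) <;> assumption⟩
  · intro h
    simp only [ZFSet.mem_pair] at h
    exact ⟨⟨(h _).2 (.inl rfl), (h _).2 (.inr rfl)⟩, fun a ha => (h a).1 ha⟩

theorem eq_pair (x y z : X) : UD fun _ w => w z = pair (w x) (w y) := by
  refine UD.congr (P := fun _ w => ∃ a, a = ({w x, w x} : ZFSet) ∧ ∃ b, b = ({w x, w y} : ZFSet) ∧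
      w z = ({a, b} : ZFSet)) ?_ fun β _ w _ => ?_
  · refine ex_of ?_ (eq_pairset _ _ _) (ex_of ?_ (eq_pairset _ _ _) (eq_pairset _ _ _))
    · rintro β hβ w hw _ rfl
      exact pairset_mem_level hβ (hw _) (hw _)
    · rintro β hβ w hw _ rfl
      exact pairset_mem_level hβ (hw _) (hw _)
  · simp [pair]

theorem pair_mem (x y f : X) : UD fun _ w => pair (w x) (w y) ∈ w f :=
  UD.congr (P := fun _ w => ∃ p ∈ w f, p = pair (w x) (w y)) (bex _ (eq_pair _ _ _))
    fun β _ w _ => by simp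

theorem pair_pair_mem (x y z f : X) : UD fun _ w => pair (w x) (pair (w y) (w z)) ∈ w f :=
  UD.congr (P := fun _ w => ∃ p, p = pair (w y) (w z) ∧ pair (w x) p ∈ w f)
    (ex_of (by rintro β hβ w hw _ rfl; exact pair_mem_level hβ (hw _) (hw _))
      (eq_pair _ _ _) (pair_mem _ _ _))
    fun β _ w _ => by simp

theorem isFunc (x y f : X) : UD fun _ w => IsFunc (w x) (w y) (w f) := by
  refine UD.congr (P := fun _ w => (∀ z ∈ w f, ∃ a ∈ w x, ∃ b ∈ w y, z = pair a b) ∧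
      ∀ a ∈ w x, ∃ b ∈ w y, pair a b ∈ w f ∧ ∀ c ∈ w y, pair a c ∈ w f → c = b)
    ((ball _ (bex _ (bex _ (eq_pair _ _ _)))).and (ball _ (bex _ ((pair_mem _ _ _).and
      (ball _ ((pair_mem _ _ _).imp (eq _ _))))))) fun β _ w _ => ?_
  unfold IsFunc
  simp only [ZFSet.subset_def, ZFSet.mem_prod]
  refine and_congr_right fun h => forall₂_congr fun a ha => ⟨?_, ?_⟩
  · rintro ⟨b, hb, h1, h2⟩
    refine ⟨b, h1, fun c hc => h2 c ?_ hc⟩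
    obtain ⟨a', _, b', hb', he⟩ := h _ hc
    rw [pair_inj] at he
    exact he.2 ▸ hb'
  · rintro ⟨b, h1, h2⟩
    obtain ⟨a', _, b', hb', he⟩ := h _ h1
    rw [pair_inj] at he
    exact ⟨b, he.2 ▸ hb', h1, fun c _ hc => h2 c hc⟩

/-- A limit level contains every function between two of its elements. Hence V_β sees all
assignments, including those of infinitely many second-order variables. -/
theorem all_isFunc (x y : X)
    (h : UD fun β (w : Option X → ZFSet.{u}) => R β (fun x => w (some x)) (w none)) :
    UD fun β w => ∀ f, IsFunc (w x) (w y) f → R β w f :=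
  all_of (S := fun _ w f => IsFunc (w x) (w y) f)
    (fun _ hβ _ hw _ hf => isFunc_mem_level hβ (hw _) (hw _) hf) (isFunc _ _ _) h

theorem relabel {Y : Type} (g : X → Y) (h : UD P) :
    UD fun β (w : Y → ZFSet.{u}) => P β fun x => w (g x) := by
  obtain ⟨φ, hφ⟩ := h
  exact ⟨φ.relabel g, fun β hβ v => by
    rw [FirstOrder.Language.Formula.realize_relabel, hφ β hβ]; rfl⟩

end UD

/-! ### Partial elementary maps transfer uniformly definable properties. -/

/-- The property of `κ` in the third condition of the theorem, for an arbitrary level `V_θ`. -/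
def EmbeddingPropertyAt (κ : Cardinal.{u}) (θ : Ordinal.{u}) : Prop :=
  ∀ D : Set (VLevel θ),
    (∀ δ ≤ κ.ord, ∃ x ∈ D, (x : ZFSet.{u}) = δ.toZFSet) → #D = lift.{u + 1} κ →
    ∃ (β : Ordinal.{u}) (j : D → VLevel β), IsPartialElementary D j ∧ IsCrit D j κ.ord

/-- Being a limit is visible through "every set is an element of a set": in V_{γ+1} the set V_γ is
an element of nothing. -/
theorem IsPartialElementary.isSuccLimit {α β : Ordinal.{u}} {D : Set (VLevel α)}
    {j : D → VLevel β} (hj : IsPartialElementary D j) (hα : IsSuccLimit α) (hD : Nonempty D) :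
    IsSuccLimit β := by
  obtain ⟨d⟩ := hD
  let φ : setLang.Formula (Fin 0) := FirstOrder.Language.Formula.iAlls Unit
    (FirstOrder.Language.Formula.iExs Unit
    (memFormula (Sum.inl (Sum.inr ()) : (Fin 0 ⊕ Unit) ⊕ Unit) (Sum.inr ())))
  have key : ∀ (γ : Ordinal.{u}) (v : Fin 0 → VLevel γ),
      φ.Realize v ↔ ∀ x : VLevel γ, ∃ y : VLevel γ, x.1 ∈ y.1 := by
    intro γ v
    simp only [φ, FirstOrder.Language.Formula.realize_iAlls,
      FirstOrder.Language.Formula.realize_iExs, realize_memFormula]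
    exact ⟨fun h x => let ⟨i, hi⟩ := h fun _ => x; ⟨i (), hi⟩,
      fun h i => let ⟨y, hy⟩ := h (i ()); ⟨fun _ => y, hy⟩⟩
  have h1 := (hj 0 φ Fin.elim0).1 ((key _ _).2 fun x =>
    ⟨⟨{x.1, x.1}, pairset_mem_level hα x.2 x.2⟩, by simp⟩)
  rw [key] at h1
  refine ⟨fun h => ?_, fun γ hγ => ?_⟩
  · have := (j d).2
    exact h.not_lt (mem_vonNeumann.1 this)
  · obtain ⟨y, hy⟩ := h1 ⟨vonNeumann γ, by simpa using hγ.lt⟩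
    have h2 := rank_lt_of_mem hy
    have h3 := mem_vonNeumann.1 y.2
    rw [rank_vonNeumann] at h2
    exact hγ.2 h2 h3

theorem IsPartialElementary.transfer {α β : Ordinal.{u}} {D : Set (VLevel α)}
    {j : D → VLevel β} (hj : IsPartialElementary D j) (hα : IsSuccLimit α) (hβ : IsSuccLimit β)
    {X : Type} [Finite X] {P : Ordinal.{u} → (X → ZFSet.{u}) → Prop} (hP : UD P) (w : X → D) :
    P α (fun x => (w x : VLevel α)) ↔ P β (fun x => (j (w x) : ZFSet.{u})) := by
  obtain ⟨n, ⟨e⟩⟩ := Finite.exists_equiv_fin X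
  obtain ⟨φ, hφ⟩ := hP.relabel e
  have := hj n φ (fun i => w (e.symm i))
  rw [hφ α hα, hφ β hβ] at this
  simpa using this

attribute [irreducible] UD

/-! ### Set-theoretic codes of second-order structures

The syntax of a theory is coded by a `Table` of sets of ordinals; the interpretation of all
its terms and formulas in a structure with universe `M` is coded by sets `V` and `S`, where
assignments are functions from `K` to `O`. -/

/-- The sets that code the syntax of a theory: `K` is the set of nodes (and of variables), `om` the
set of natural numbers, `hd`, `ln`, `ar`, `kn` and `rt` are graphs of functions and `tg n` is the set of
nodes of type `n`. -/
structure Table (α : Type*) where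
  K : α
  om : α
  hd : α
  ln : α
  ar : α
  kn : α
  rt : α
  tg : Fin 9 → α

/-- Applying a function to all components of a table. -/
def Table.map {α β : Type*} (w : α → β) (t : Table α) : Table β :=
  ⟨w t.K, w t.om, w t.hd, w t.ln, w t.ar, w t.kn, w t.rt, fun n => w (t.tg n)⟩

/-- `a` codes an object of the kind coded by `k` over the universe `M`. -/
def IsKind (om M k a : ZFSet.{u}) : Prop :=
  (k ∈ om ∧ ∀ u ∈ a, IsFunc k M u) ∨ (k = om ∧ a ∈ M)

namespace Table

variable (t : Table ZFSet.{u}) (M O V S ξ : ZFSet.{u})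

/-- The entries of `u` with indices in `l` are the values under the assignment `v` of the argument
nodes of `ξ`. -/
def Match (l v u : ZFSet.{u}) : Prop :=
  ∀ i ∈ l, ∀ b ∈ O, pair i b ∈ u → ∀ η ∈ t.K, pair ξ (pair i η) ∈ t.ar → pair η (pair v b) ∈ V

/-- Assignments are arbitrary functions from K to O that need not respect kinds. The value of a
variable is therefore prescribed only when its entry has the right kind. -/
def VarClause : Prop :=
  ∀ x ∈ t.K, pair ξ x ∈ t.hd → ∀ k ∈ t.K, pair ξ k ∈ t.ln → ∀ v, IsFunc t.K O v →
    ∀ a ∈ O, IsKind t.om M k a → pair x a ∈ v → ∀ b ∈ O, (pair ξ (pair v b) ∈ V ↔ b = a)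

/-- V serves terms and function symbols alike: at a symbol node the second coordinate is an argument
list instead of an assignment. The list u is total on K, and only its entries at argument places are
constrained. -/
def AppClause : Prop :=
  ∀ f ∈ t.K, pair ξ f ∈ t.hd → ∀ l ∈ t.K, pair ξ l ∈ t.ln → ∀ v, IsFunc t.K O v →
    ∀ u, IsFunc t.K O u → t.Match O V ξ l v u →
      ∀ a ∈ O, (pair ξ (pair v a) ∈ V ↔ pair f (pair u a) ∈ V)

/-- Existence, uniqueness and kind of values are demanded for symbols; compound terms inherit them
through `AppClause`. -/
def FnClause : Prop :=
  ∀ k ∈ t.K, pair ξ k ∈ t.ln → ∀ u, IsFunc t.K O u →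
    ∃ a ∈ O, IsKind t.om M k a ∧ ∀ b ∈ O, (pair ξ (pair u b) ∈ V ↔ b = a)

def EqClause : Prop :=
  ∀ η ∈ t.K, pair ξ η ∈ t.hd → ∀ ζ ∈ t.K, pair ξ ζ ∈ t.ln → ∀ v, IsFunc t.K O v →
    (pair ξ v ∈ S ↔ ∃ a ∈ O, pair η (pair v a) ∈ V ∧ pair ζ (pair v a) ∈ V)

def MemClause : Prop :=
  ∀ η ∈ t.K, pair ξ η ∈ t.hd → ∀ n ∈ t.K, pair ξ n ∈ t.ln → ∀ v, IsFunc t.K O v →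
    (pair ξ v ∈ S ↔ ∃ A ∈ O, pair η (pair v A) ∈ V ∧ ∃ u ∈ A, t.Match O V ξ n v u)

def RelClause : Prop :=
  ∀ r ∈ t.K, pair ξ r ∈ t.hd → ∀ l ∈ t.K, pair ξ l ∈ t.ln → ∀ v, IsFunc t.K O v →
    ∀ u, IsFunc t.K O u → t.Match O V ξ l v u → (pair ξ v ∈ S ↔ pair r u ∈ S)

def NegClause : Prop :=
  ∀ η ∈ t.K, pair ξ η ∈ t.hd → ∀ v, IsFunc t.K O v → (pair ξ v ∈ S ↔ ¬ pair η v ∈ S)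

def ConjClause : Prop :=
  ∀ l ∈ t.K, pair ξ l ∈ t.ln → ∀ v, IsFunc t.K O v →
    (pair ξ v ∈ S ↔ ∀ i ∈ l, ∀ η ∈ t.K, pair ξ (pair i η) ∈ t.ar → pair η v ∈ S)

/-- The assignments `v` and `w` agree except on the variables bound at the node `ξ`. -/
def Agree (l v w : ZFSet.{u}) : Prop :=
  ∀ x ∈ t.K, (∀ i ∈ l, ∀ y ∈ t.K, pair ξ (pair i y) ∈ t.ar → ¬ y = x) →
    ∀ b ∈ O, pair x b ∈ v → pair x b ∈ w

/-- The assignment `w` respects the kinds of the variables bound at the node `ξ`. -/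
def Typed (l w : ZFSet.{u}) : Prop :=
  ∀ i ∈ l, ∀ y ∈ t.K, pair ξ (pair i y) ∈ t.ar → ∀ k ∈ t.K, pair ξ (pair i k) ∈ t.kn →
    ∃ b ∈ O, pair y b ∈ w ∧ IsKind t.om M k b

/-- A whole block of quantifiers becomes one quantifier over total assignments w, so its length
plays no role in the first-order complexity of the clause. -/
def AllClause : Prop :=
  ∀ η ∈ t.K, pair ξ η ∈ t.hd → ∀ l ∈ t.K, pair ξ l ∈ t.ln → ∀ v, IsFunc t.K O v →
    (pair ξ v ∈ S ↔ ∀ w, IsFunc t.K O w → t.Agree O ξ l v w → t.Typed M O ξ l w →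
      pair η w ∈ S)

/-- `O` contains the codes of all objects over the nonempty universe `M`. -/
def Full : Prop :=
  (∃ m ∈ M, m = m) ∧ (∀ a ∈ M, a ∈ O) ∧ ∀ n ∈ t.om, ∀ A, (∀ u ∈ A, IsFunc n M u) → A ∈ O

/-- `M`, `O`, `V`, `S` code a structure in which the first `α` sentences of the theory are true. -/
def Models (α : ZFSet.{u}) : Prop :=
  t.Full M O ∧ (∀ i ∈ α, ∀ η ∈ t.K, pair i η ∈ t.rt → ∀ v, IsFunc t.K O v → pair η v ∈ S) ∧
  (∀ ξ ∈ t.K, ξ ∈ t.tg 0 → t.VarClause M O V ξ) ∧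
  (∀ ξ ∈ t.K, ξ ∈ t.tg 1 → t.AppClause O V ξ) ∧
  (∀ ξ ∈ t.K, ξ ∈ t.tg 2 → t.FnClause M O V ξ) ∧
  (∀ ξ ∈ t.K, ξ ∈ t.tg 3 → t.EqClause O V S ξ) ∧
  (∀ ξ ∈ t.K, ξ ∈ t.tg 4 → t.MemClause O V S ξ) ∧
  (∀ ξ ∈ t.K, ξ ∈ t.tg 5 → t.RelClause O V S ξ) ∧
  (∀ ξ ∈ t.K, ξ ∈ t.tg 6 → t.NegClause O S ξ) ∧
  (∀ ξ ∈ t.K, ξ ∈ t.tg 7 → t.ConjClause O S ξ) ∧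
  (∀ ξ ∈ t.K, ξ ∈ t.tg 8 → t.AllClause M O S ξ)

end Table

/-! ### Truth in coded structures is uniformly definable. -/

namespace UD

variable {X : Type}

theorem isKind (om m k a : X) : UD fun _ w => IsKind (w om) (w m) (w k) (w a) :=
  ((mem _ _).and (ball _ (isFunc _ _ _))).or ((eq _ _).and (mem _ _))

theorem full (t : Table X) (m o : X) : UD fun _ w => (t.map w).Full (w m) (w o) := by
  unfold Table.Full
  dsimp only [Table.map]
  refine and ?_ (and ?_ (ball _ (all_of ?_ ?_ ?_)))
  · with_reducible exact bex _ (eq _ _)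
  · with_reducible exact ball _ (mem _ _)
  · intro β hβ w hw A hA
    refine mem_vonNeumann_of_subset (fun u hu => ?_)
      (powerset_mem_level hβ (prod_mem_level hβ (hw none) (hw (some m))))
    exact ZFSet.mem_powerset.2 (hA u hu).1
  · with_reducible exact ball _ (isFunc _ _ _)
  · with_reducible exact mem _ _

/-- Apart from `Full`, every clause is built by connectives from atoms, quantifiers bounded by sets,
and quantifiers over functions from K to O. The closure properties above therefore apply along the
syntax. -/
theorem models (t : Table X) (m o v s a : X) :
    UD fun _ w => (t.map w).Models (w m) (w o) (w v) (w s) (w a) := by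
  refine and (full t m o) ?_
  unfold Table.VarClause Table.AppClause Table.FnClause Table.EqClause Table.MemClause
    Table.RelClause Table.NegClause Table.ConjClause Table.AllClause Table.Match Table.Agree
    Table.Typed
  dsimp only [Table.map]
  repeat' first
    | with_reducible apply ball | with_reducible apply bex | with_reducible apply all_isFunc
    | with_reducible apply pair_mem | with_reducible apply pair_pair_mem
    | with_reducible apply isKind | with_reducible apply eq | with_reducible apply mem
    | with_reducible apply and | with_reducible apply iff | with_reducible apply not
    | with_reducible apply imp

/-- Each initial segment of the theory coded by `t` has a model in `V_β`. -/
theorem forall_exists_models (t : Table X) :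
    UD fun β w => ∀ α ∈ (t.map w).K, ∃ M ∈ vonNeumann β, ∃ O ∈ vonNeumann β,
      ∃ V ∈ vonNeumann β, ∃ S ∈ vonNeumann β, (t.map w).Models M O V S α :=
  ball t.K (ex (ex (ex (ex (models ((((t.map some).map some).map some).map some |>.map some)
    (some (some (some none))) (some (some none)) (some none) none
    (some (some (some (some none)))))))))

end UD

/-! ### Ordinals below `κ` as indices -/

/-- The ordinals below `κ`. -/
abbrev Idx (κ : Cardinal.{u}) : Type u := κ.ord.ToType

section Idx

variable {κ : Cardinal.{u}}

/-- An index as a von Neumann ordinal. -/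
noncomputable def Idx.set (i : Idx κ) : ZFSet.{u} := (i.toOrd : Ordinal.{u}).toZFSet

theorem Idx.set_injective : Function.Injective (Idx.set (κ := κ)) := fun i j h => by
  simpa using Subtype.ext (Ordinal.toZFSet_injective h)

@[simp] theorem Idx.set_inj {i j : Idx κ} : i.set = j.set ↔ i = j := Idx.set_injective.eq_iff

theorem Idx.set_mk {o : Ordinal.{u}} (h : o < κ.ord) :
    Idx.set (κ := κ) (Ordinal.ToType.mk ⟨o, h⟩) = o.toZFSet := by
  simp [Idx.set]

theorem mem_toZFSet_ord {x : ZFSet.{u}} : x ∈ κ.ord.toZFSet ↔ ∃ i : Idx κ, i.set = x := by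
  rw [Ordinal.mem_toZFSet_iff]
  constructor
  · rintro ⟨a, ha, rfl⟩
    exact ⟨_, Idx.set_mk ha⟩
  · rintro ⟨i, rfl⟩
    exact ⟨_, i.toOrd.2, rfl⟩

theorem Idx.set_mem_set {i j : Idx κ} : i.set ∈ j.set ↔ i < j := by
  rw [Idx.set, Idx.set, Ordinal.toZFSet_mem_toZFSet_iff, Subtype.coe_lt_coe]
  exact Ordinal.ToType.mk.symm.lt_iff_lt

theorem Idx.mem_set {j : Idx κ} {x : ZFSet.{u}} : x ∈ j.set ↔ ∃ i < j, i.set = x := by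
  constructor
  · intro h
    obtain ⟨a, ha, rfl⟩ := Ordinal.mem_toZFSet_iff.1 h
    refine ⟨Ordinal.ToType.mk ⟨a, ha.trans j.toOrd.2⟩, ?_, Idx.set_mk _⟩
    rw [← Idx.set_mem_set, Idx.set_mk]
    exact h
  · rintro ⟨i, h, rfl⟩
    exact Idx.set_mem_set.2 h

variable [hκ : Fact (ℵ₀ < κ)]

/-- Uncountability enters here: ω is an index, so the codes of all kinds lie below κ and are fixed
by an embedding with critical point κ. -/
theorem omega0_lt_ord : Ordinal.omega0.{u} < κ.ord := by
  rw [← Cardinal.ord_aleph0]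
  exact Cardinal.ord_lt_ord.2 hκ.out

/-- The natural numbers among the indices. -/
noncomputable def Idx.nat (n : ℕ) : Idx κ :=
  Ordinal.ToType.mk ⟨n, (Ordinal.natCast_lt_omega0 n).trans omega0_lt_ord⟩

/-- The index `ω`. -/
noncomputable def Idx.omega : Idx κ := Ordinal.ToType.mk ⟨Ordinal.omega0, omega0_lt_ord⟩

instance : Nonempty (Idx κ) := ⟨Idx.omega⟩

theorem Idx.mem_set_nat {n : ℕ} {x : ZFSet.{u}} :
    x ∈ (Idx.nat (κ := κ) n).set ↔ ∃ i : Fin n, (Idx.nat (κ := κ) i).set = x := by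
  rw [Idx.nat, Idx.set_mk, Ordinal.mem_toZFSet_iff]
  constructor
  · rintro ⟨a, ha, rfl⟩
    obtain ⟨m, rfl⟩ := Ordinal.lt_omega0.1 (ha.trans (Ordinal.natCast_lt_omega0 n))
    exact ⟨⟨m, by exact_mod_cast ha⟩, by rw [Idx.nat, Idx.set_mk]⟩
  · rintro ⟨i, rfl⟩
    exact ⟨(i : ℕ), by exact_mod_cast i.2, by rw [Idx.nat, Idx.set_mk]⟩

theorem Idx.mem_set_omega {x : ZFSet.{u}} :
    x ∈ (Idx.omega (κ := κ)).set ↔ ∃ n : ℕ, (Idx.nat (κ := κ) n).set = x := by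
  rw [Idx.omega, Idx.set_mk, Ordinal.mem_toZFSet_iff]
  constructor
  · rintro ⟨a, ha, rfl⟩
    obtain ⟨m, rfl⟩ := Ordinal.lt_omega0.1 ha
    exact ⟨m, by rw [Idx.nat, Idx.set_mk]⟩
  · rintro ⟨i, rfl⟩
    exact ⟨(i : ℕ), Ordinal.natCast_lt_omega0 i, by rw [Idx.nat, Idx.set_mk]⟩

theorem Idx.nat_injective : Function.Injective (Idx.nat (κ := κ)) := fun m n h => by
  have : (m : Ordinal.{u}) = n := Subtype.ext_iff.1 (Ordinal.ToType.mk.injective h)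
  exact_mod_cast this

/-- The index of a kind. -/
noncomputable def kindIdx : Kind.{u} → Idx κ
  | .ind => Idx.omega
  | .set n => Idx.nat n

/-- Every type of size `< κ` is enumerated by an initial segment of the indices. -/
theorem exists_enumeration (I : Type u) : ∃ p : Idx κ × (I → Idx κ),
    #I < κ → Function.Injective p.2 ∧ ∀ i, i < p.1 ↔ ∃ a, p.2 a = i := by
  by_cases h : #I < κ
  · have hlt : (#I).ord < κ.ord := Cardinal.ord_lt_ord.2 h
    let e : I ≃ (#I).ord.ToType := Classical.choice (Cardinal.eq.1 (by simp))
    refine ⟨⟨Ordinal.ToType.mk ⟨_, hlt⟩, fun a =>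
      Ordinal.ToType.mk ⟨(e a).toOrd, Set.mem_Iio.2 (lt_trans (Set.mem_Iio.1 (e a).toOrd.2) hlt)⟩⟩,
      fun _ => ⟨fun a b hab => ?_,
      fun i => ⟨fun hi => ?_, ?_⟩⟩⟩
    · have := Subtype.ext_iff.1 (Ordinal.ToType.mk.injective hab)
      exact e.injective (Ordinal.ToType.mk.symm.injective (Subtype.ext this))
    · have hi' : (i.toOrd : Ordinal) < (#I).ord := by
        have h3 := (Ordinal.ToType.mk.symm.lt_iff_lt).2 hi
        rw [OrderIso.symm_apply_apply] at h3
        exact h3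
      refine ⟨e.symm (Ordinal.ToType.mk ⟨i.toOrd, Set.mem_Iio.2 hi'⟩), ?_⟩
      simp
    · rintro ⟨a, rfl⟩
      exact Ordinal.ToType.mk.lt_iff_lt.2 (Subtype.mk_lt_mk.2 (e a).toOrd.2)
  -- Junk for types of size at least κ, so that `lenOf` and `ixOf` need no size hypothesis.
  · exact ⟨⟨Classical.arbitrary _, fun _ => Classical.arbitrary _⟩, fun h' => absurd h' h⟩

/-- The length of the enumeration of `I`. -/
noncomputable def lenOf (I : Type u) : Idx κ := (exists_enumeration I).choose.1

/-- The enumeration of `I`. -/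
noncomputable def ixOf (I : Type u) : I → Idx κ := (exists_enumeration I).choose.2

theorem ixOf_injective {I : Type u} (h : #I < κ) : Function.Injective (ixOf (κ := κ) I) :=
  ((exists_enumeration I).choose_spec h).1

theorem mem_set_lenOf {I : Type u} (h : #I < κ) {x : ZFSet.{u}} :
    x ∈ (lenOf (κ := κ) I).set ↔ ∃ a, (ixOf (κ := κ) I a).set = x := by
  rw [Idx.mem_set]
  constructor
  · rintro ⟨i, hi, rfl⟩
    obtain ⟨a, rfl⟩ := (((exists_enumeration I).choose_spec h).2 i).1 hi
    exact ⟨a, rfl⟩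
  · rintro ⟨a, rfl⟩
    exact ⟨_, (((exists_enumeration I).choose_spec h).2 _).2 ⟨a, rfl⟩, rfl⟩

end Idx

/-! ### Codes of objects -/

section Code

variable (κ : Cardinal.{u}) [hκ : Fact (ℵ₀ < κ)] {M : Type u} (b : M → ZFSet.{u})

/-- The set-theoretic function on `n` that corresponds to a tuple. -/
noncomputable def tupleCode {n : ℕ} (t : Fin n → M) : ZFSet.{u} :=
  range fun i : Fin n => pair (Idx.nat (κ := κ) i).set (b (t i))

/-- The code of an object. -/
noncomputable def code : (k : Kind.{u}) → k.Obj M → ZFSet.{u}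
  | .ind, m => b m
  | .set n, A =>
    let A' : Set (Fin n → M) := A
    range fun t : A' => tupleCode κ b t.1

variable {κ b}

theorem pair_mem_tupleCode {n : ℕ} {t : Fin n → M} {i : Fin n} {x : ZFSet.{u}} :
    pair (Idx.nat (κ := κ) i).set x ∈ tupleCode κ b t ↔ x = b (t i) := by
  rw [tupleCode, mem_range]
  constructor
  · rintro ⟨j, hj⟩
    rw [pair_inj, Idx.set_inj] at hj
    obtain rfl := Fin.ext (Idx.nat_injective hj.1)
    exact hj.2.symm
  · rintro rfl
    exact ⟨i, rfl⟩

theorem mem_code_set {n : ℕ} {A : Set (Fin n → M)} {x : ZFSet.{u}} :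
    x ∈ code κ b (.set n) A ↔ ∃ t ∈ A, tupleCode κ b t = x :=
  mem_range.trans ⟨fun ⟨t, h⟩ => ⟨t.1, t.2, h⟩, fun ⟨t, h, h'⟩ => ⟨⟨t, h⟩, h'⟩⟩

variable (hb : Function.Injective b)
include hb

theorem tupleCode_injective {n : ℕ} :
    Function.Injective (tupleCode κ b : (Fin n → M) → ZFSet.{u}) := fun t t' h => by
  funext i
  have := pair_mem_tupleCode (κ := κ) (b := b) (t := t) (i := i) (x := b (t i))
  rw [h, pair_mem_tupleCode] at this
  exact hb (this.2 rfl)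

theorem tupleCode_mem_code {n : ℕ} {A : Set (Fin n → M)} {t : Fin n → M} :
    tupleCode κ b t ∈ code κ b (.set n) A ↔ t ∈ A := by
  rw [mem_code_set]
  constructor
  · rintro ⟨t', h, ht⟩
    rwa [← tupleCode_injective hb ht]
  · exact fun h => ⟨t, h, rfl⟩

theorem code_injective (k : Kind.{u}) : Function.Injective (code κ b k) := by
  cases k with
  | ind => exact hb
  | set n =>
    intro A B h
    have : ∀ A B : Set (Fin n → M), code κ b (.set n) A = code κ b (.set n) B → A = B := by
      intro A B h
      ext t
      rw [← tupleCode_mem_code (κ := κ) hb, ← tupleCode_mem_code (κ := κ) hb, h]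
    exact this A B h

omit hb
variable {M₀ : ZFSet.{u}} (hM : ∀ x, x ∈ M₀ ↔ ∃ m, b m = x)
include hM

theorem isFunc_iff_exists_tuple {n : ℕ} {u : ZFSet.{u}} :
    IsFunc (Idx.nat (κ := κ) n).set M₀ u ↔ ∃ t : Fin n → M, tupleCode κ b t = u := by
  constructor
  · rintro ⟨h1, h2⟩
    have h3 : ∀ i : Fin n, ∃ m, pair (Idx.nat (κ := κ) i).set (b m) ∈ u := fun i => by
      obtain ⟨x, hx, -⟩ := h2 _ (Idx.mem_set_nat.2 ⟨i, rfl⟩)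
      obtain ⟨m, rfl⟩ := (hM x).1 (pair_mem_prod.1 (h1 hx)).2
      exact ⟨m, hx⟩
    choose t ht using h3
    refine ⟨t, ZFSet.ext fun z => ?_⟩
    rw [tupleCode, mem_range]
    constructor
    · rintro ⟨i, rfl⟩
      exact ht i
    · intro hz
      obtain ⟨x, hx, y, hy, rfl⟩ := ZFSet.mem_prod.1 (h1 hz)
      obtain ⟨i, rfl⟩ := Idx.mem_set_nat.1 hx
      exact ⟨i, by rw [(h2 _ hx).unique (ht i) hz]⟩
  · rintro ⟨t, rfl⟩
    refine ⟨fun z hz => ?_, fun z hz => ?_⟩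
    · obtain ⟨i, rfl⟩ := mem_range.1 hz
      exact pair_mem_prod.2 ⟨Idx.mem_set_nat.2 ⟨i, rfl⟩, (hM _).2 ⟨_, rfl⟩⟩
    · obtain ⟨i, rfl⟩ := Idx.mem_set_nat.1 hz
      exact ⟨b (t i), pair_mem_tupleCode.2 rfl, fun y hy => pair_mem_tupleCode.1 hy⟩

/-- Any set of functions from n to M is the code of the set of tuples whose codes it contains, so
the set-theoretic notion captures exactly the objects of the standard semantics. -/
theorem isKind_iff {k : Kind.{u}} {a : ZFSet.{u}} :
    IsKind (Idx.omega (κ := κ)).set M₀ (kindIdx (κ := κ) k).set a ↔ ∃ o, code κ b k o = a := by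
  cases k with
  | ind =>
    rw [kindIdx, IsKind]
    simp only [mem_irrefl, false_and, true_and, false_or]
    exact hM a
  | set n =>
    have h1 : (Idx.nat (κ := κ) n).set ∈ (Idx.omega (κ := κ)).set :=
      Idx.mem_set_omega.2 ⟨n, rfl⟩
    have h2 : (Idx.nat (κ := κ) n).set ≠ (Idx.omega (κ := κ)).set := fun h =>
      mem_irrefl _ (h ▸ h1)
    simp only [kindIdx, IsKind, h1, h2, true_and, false_and, or_false, isFunc_iff_exists_tuple hM]
    constructor
    · intro h
      refine ⟨({t | tupleCode κ b t ∈ a} : Set (Fin n → M)), ZFSet.ext fun z => ?_⟩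
      rw [mem_code_set]
      constructor
      · rintro ⟨t, ht, rfl⟩
        exact ht
      · intro hz
        obtain ⟨t, rfl⟩ := h z hz
        exact ⟨t, hz, rfl⟩
    · rintro ⟨A, rfl⟩ u hu
      obtain ⟨t, -, rfl⟩ := mem_code_set.1 hu
      exact ⟨t, rfl⟩

end Code

/-! ### Terms and formulas as nodes, numbered by the ordinals below `κ` -/

/-- Occurrences of terms, symbols and formulas, with names for their free variables. The names
`(n, i)` of the free variables of a formula at depth `d` satisfy `n < d`. -/
inductive Node (L : Language.{u}) (κ : Cardinal.{u}) : Type (u + 1)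
  | term {X : Type u} {Γ : X → Kind.{u}} {k : Kind.{u}} (t : Term L Γ k) (e : X → ℕ × Idx κ)
  | fn (f : L.Fn)
  | rl (r : L.Rl)
  | form {X : Type u} {Γ : X → Kind.{u}} (φ : Formula L Γ) (d : ℕ) (e : X → ℕ × Idx κ)

namespace Node

variable {L : Language.{u}} {κ : Cardinal.{u}} [hκ : Fact (ℵ₀ < κ)]

/-- The names of the variables below a quantifier. -/
noncomputable def bind {X Y : Type u} (d : ℕ) (e : X → ℕ × Idx κ) : X ⊕ Y → ℕ × Idx κ :=
  Sum.elim e fun y => (d, ixOf Y y)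

/-- The immediate constituents of a node. -/
def kids : Node L κ → Set (Node L κ)
  | @term _ _ _X _Γ _ (.var _) _ => ∅
  | term (.app f ts) e => insert (fn f) (Set.range fun i => term (ts i) e)
  | fn _ => ∅
  | rl _ => ∅
  | form (.eq t s) _ e => {term t e, term s e}
  | form (.mem ts A) _ e => insert (term A e) (Set.range fun i => term (ts i) e)
  | form (.rel r ts) _ e => insert (rl r) (Set.range fun i => term (ts i) e)
  | form (.neg φ) d e => {form φ d e}
  | form (.conj φ) d e => Set.range fun i => form (φ i) d e
  | form (.all _ φ) d e => {form φ (d + 1) (bind d e)}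

/-- The formulas in the logic with correctly named variables; all terms and symbols. -/
def Ok : Node L κ → Prop
  | form φ d e => φ.InL2 κ κ ∧ ∀ x, (e x).1 < d
  | _ => True

/-- The invariant survives a quantifier at depth d because the new names carry d and the body has
depth d + 1. It keeps bound names distinct from the free ones. -/
theorem Ok.kid {n m : Node L κ} (hn : n.Ok) (hm : m ∈ n.kids) : m.Ok := by
  match n, hn, hm with
  | @term _ _ _X _Γ _ (.var _) _, _, hm => exact hm.elim
  | term (.app f ts) e, _, hm =>
    obtain rfl | ⟨i, rfl⟩ := hm <;> trivial
  | fn _, _, hm => exact hm.elim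
  | rl _, _, hm => exact hm.elim
  | form (.eq t s) _ e, _, hm =>
    obtain rfl | rfl := hm <;> trivial
  | form (.mem ts A) _ e, _, hm =>
    obtain rfl | ⟨i, rfl⟩ := hm <;> trivial
  | form (.rel r ts) _ e, _, hm =>
    obtain rfl | ⟨i, rfl⟩ := hm <;> trivial
  | form (.neg φ) d e, hn, hm =>
    obtain rfl := hm
    exact hn
  | form (.conj φ) d e, hn, hm =>
    obtain ⟨i, rfl⟩ := hm
    exact ⟨hn.1.2 i, hn.2⟩
  | form (.all _ φ) d e, hn, hm =>
    obtain rfl := hm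
    refine ⟨hn.1.2, ?_⟩
    rintro (x | y)
    · exact (hn.2 x).trans (Nat.lt_succ_self d)
    · exact Nat.lt_succ_self d

omit hκ in
theorem insert_range_subset {α : Type*} {I : Type*} {ix : I → Idx κ}
    (hix : Function.Injective ix) (a : α) (h : I → α) :
    ∃ g : Option (Idx κ) → α, insert a (Set.range h) ⊆ Set.range g := by
  refine ⟨fun o => o.elim a (Function.extend ix h fun _ => a), ?_⟩
  rintro _ (rfl | ⟨i, rfl⟩)
  · exact ⟨none, rfl⟩
  · exact ⟨some (ix i), hix.extend_apply h (fun _ => a) i⟩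

theorem exists_kids_subset_range (hL : L.ArityLT κ) (n : Node L κ) (hn : n.Ok) :
    ∃ g : Option (Idx κ) → Node L κ, n.kids ⊆ Set.range g := by
  match n, hn with
  | @term _ _ _X _Γ _ (.var _) _, _ => exact ⟨fun _ => n, Set.empty_subset _⟩
  | term (.app f ts) e, _ => exact insert_range_subset (ixOf_injective (hL.1 f)) _ _
  | fn _, _ => exact ⟨fun _ => n, Set.empty_subset _⟩
  | rl _, _ => exact ⟨fun _ => n, Set.empty_subset _⟩
  | form (.eq t s) _ e, _ =>
    refine ⟨fun o => o.elim (term t e) fun _ => term s e, ?_⟩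
    rintro _ (rfl | rfl)
    exacts [⟨none, rfl⟩, ⟨some Idx.omega, rfl⟩]
  | form (.mem ts A) _ e, _ =>
    exact insert_range_subset (ix := fun i : Fin _ => Idx.nat (κ := κ) i)
      (fun i j h => Fin.ext (Idx.nat_injective h)) _ _
  | form (.rel r ts) _ e, _ => exact insert_range_subset (ixOf_injective (hL.2 r)) _ _
  | form (.neg φ) d e, _ => exact ⟨fun _ => form φ d e, by rintro _ rfl; exact ⟨none, rfl⟩⟩
  | form (.conj φ) d e, hn =>
    obtain ⟨g, hg⟩ := insert_range_subset (ixOf_injective hn.1.1) n fun i => form (φ i) d e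
    exact ⟨g, fun _ h => hg (Set.mem_insert_of_mem _ h)⟩
  | form (.all _ φ) d e, _ =>
    exact ⟨fun _ => form φ (d + 1) (bind d e), by rintro _ rfl; exact ⟨none, rfl⟩⟩

/-- Any `κ` nodes are contained in a set of `κ` nodes closed under immediate constituents. -/
theorem exists_numbering (hL : L.ArityLT κ) (A : Idx κ → Node L κ) (hA : ∀ i, (A i).Ok) :
    ∃ N : Idx κ → Node L κ, (∀ ξ, (N ξ).Ok) ∧ (∀ i, A i ∈ Set.range N) ∧
      ∀ ξ, (N ξ).kids ⊆ Set.range N := by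
  have : ∀ n : {n : Node L κ // n.Ok}, ∃ g : Option (Idx κ) → {n : Node L κ // n.Ok},
      ∀ m (hm : m ∈ n.1.kids), ⟨m, n.2.kid hm⟩ ∈ Set.range g := by
    classical
    intro n
    obtain ⟨g, hg⟩ := exists_kids_subset_range hL n.1 n.2
    refine ⟨fun o => if h : (g o).Ok then ⟨g o, h⟩ else n, fun m hm => ?_⟩
    obtain ⟨o, rfl⟩ := hg hm
    exact ⟨o, dif_pos (n.2.kid hm)⟩
  choose g hg using this
  -- A node of the closure is reached from a root by a finite path of constituent indices. There are
  -- only κ pairs of a root and a path, whether or not κ is regular.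
  let F : Idx κ × List (Option (Idx κ)) → {n : Node L κ // n.Ok} := fun p =>
    p.2.foldr (fun o n => g n o) ⟨A p.1, hA p.1⟩
  have hinf : Infinite (Idx κ) := by
    rw [Cardinal.infinite_iff, Cardinal.mk_ord_toType]
    exact hκ.out.le
  obtain ⟨E⟩ : Nonempty (Idx κ ≃ Idx κ × List (Option (Idx κ))) := by
    rw [← Cardinal.eq, Cardinal.mk_prod, Cardinal.mk_list_eq_mk, Cardinal.mk_option,
      Cardinal.add_one_eq (Cardinal.infinite_iff.1 hinf), Cardinal.lift_id,
      Cardinal.mul_eq_self (Cardinal.infinite_iff.1 hinf)]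
  refine ⟨fun ξ => (F (E ξ)).1, fun ξ => (F (E ξ)).2, fun i => ⟨E.symm (i, []), ?_⟩,
    fun ξ m hm => ?_⟩
  · simp [F]
  · obtain ⟨o, ho⟩ := hg _ m hm
    refine ⟨E.symm ((E ξ).1, o :: (E ξ).2), ?_⟩
    simp only [Equiv.apply_symm_apply]
    exact congrArg Subtype.val ho

end Node

/-! ### The table of a numbering of nodes -/

/-- Syntactic data of a theory, in terms of the numbers of nodes. -/
structure Coding (κ : Cardinal.{u}) where
  tg : Idx κ → Option (Fin 9)
  hd : Idx κ → Idx κ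
  ln : Idx κ → Idx κ
  ar : Idx κ → Idx κ → Idx κ
  kn : Idx κ → Idx κ → Idx κ
  rt : Idx κ → Idx κ

/-- The table `t` extends the data `C`, which it determines for arguments below `κ`. -/
structure Coding.Reads {κ : Cardinal.{u}} [Fact (ℵ₀ < κ)] (C : Coding κ) (t : Table ZFSet.{u}) :
    Prop where
  K : ∀ i : Idx κ, i.set ∈ t.K
  om : t.om = (Idx.omega (κ := κ)).set
  tg : ∀ ξ n, ξ.set ∈ t.tg n ↔ C.tg ξ = some n
  hd : ∀ ξ z, pair ξ.set z ∈ t.hd ↔ z = (C.hd ξ).set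
  ln : ∀ ξ z, pair ξ.set z ∈ t.ln ↔ z = (C.ln ξ).set
  rt : ∀ ξ z, pair ξ.set z ∈ t.rt ↔ z = (C.rt ξ).set
  ar : ∀ ξ i z, pair ξ.set (pair i.set z) ∈ t.ar ↔ z = (C.ar ξ i).set
  kn : ∀ ξ i z, pair ξ.set (pair i.set z) ∈ t.kn ↔ z = (C.kn ξ i).set

section Graph

variable {κ : Cardinal.{u}}

/-- The graph of a function as a set. -/
noncomputable def graph (h : Idx κ → Idx κ) : ZFSet.{u} := range fun ξ => pair ξ.set (h ξ).set

/-- The graph of a binary function as a set. -/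
noncomputable def graph₂ (h : Idx κ → Idx κ → Idx κ) : ZFSet.{u} :=
  range fun p : Idx κ × Idx κ => pair p.1.set (pair p.2.set (h p.1 p.2).set)

theorem pair_mem_graph {h : Idx κ → Idx κ} {ξ : Idx κ} {z : ZFSet.{u}} :
    pair ξ.set z ∈ graph h ↔ z = (h ξ).set := by
  rw [graph, mem_range]
  constructor
  · rintro ⟨i, hi⟩
    rw [pair_inj, Idx.set_inj] at hi
    obtain ⟨rfl, rfl⟩ := hi
    rfl
  · rintro rfl
    exact ⟨ξ, rfl⟩

theorem pair_mem_graph₂ {h : Idx κ → Idx κ → Idx κ} {ξ i : Idx κ} {z : ZFSet.{u}} :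
    pair ξ.set (pair i.set z) ∈ graph₂ h ↔ z = (h ξ i).set := by
  rw [graph₂, mem_range]
  constructor
  · rintro ⟨⟨ξ', i'⟩, hi⟩
    rw [pair_inj, pair_inj, Idx.set_inj, Idx.set_inj] at hi
    obtain ⟨rfl, rfl, rfl⟩ := hi
    rfl
  · rintro rfl
    exact ⟨(ξ, i), rfl⟩

theorem graph_subset (h : Idx κ → Idx κ) : graph h ⊆ prod κ.ord.toZFSet κ.ord.toZFSet := by
  intro z hz
  obtain ⟨ξ, rfl⟩ := mem_range.1 hz
  exact pair_mem_prod.2 ⟨mem_toZFSet_ord.2 ⟨_, rfl⟩, mem_toZFSet_ord.2 ⟨_, rfl⟩⟩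

theorem graph₂_subset (h : Idx κ → Idx κ → Idx κ) :
    graph₂ h ⊆ prod κ.ord.toZFSet (prod κ.ord.toZFSet κ.ord.toZFSet) := by
  intro z hz
  obtain ⟨ξ, rfl⟩ := mem_range.1 hz
  exact pair_mem_prod.2 ⟨mem_toZFSet_ord.2 ⟨_, rfl⟩, pair_mem_prod.2
    ⟨mem_toZFSet_ord.2 ⟨_, rfl⟩, mem_toZFSet_ord.2 ⟨_, rfl⟩⟩⟩

end Graph

section Table

variable {κ : Cardinal.{u}} [hκ : Fact (ℵ₀ < κ)]

/-- The table of given data. -/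
noncomputable def Coding.table (C : Coding κ) : Table ZFSet.{u} where
  K := κ.ord.toZFSet
  om := (Idx.omega (κ := κ)).set
  hd := graph C.hd
  ln := graph C.ln
  ar := graph₂ C.ar
  kn := graph₂ C.kn
  rt := graph C.rt
  tg n := κ.ord.toZFSet.sep fun x => ∃ ξ : Idx κ, ξ.set = x ∧ C.tg ξ = some n

theorem Coding.reads_table (C : Coding κ) : C.Reads C.table where
  K _ := mem_toZFSet_ord.2 ⟨_, rfl⟩
  om := rfl
  tg ξ n := by
    simp only [Coding.table, ZFSet.mem_sep, Idx.set_inj, exists_eq_left, and_iff_right_iff_imp]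
    exact fun _ => mem_toZFSet_ord.2 ⟨_, rfl⟩
  hd _ _ := pair_mem_graph
  ln _ _ := pair_mem_graph
  rt _ _ := pair_mem_graph
  ar _ _ _ := pair_mem_graph₂
  kn _ _ _ := pair_mem_graph₂

/-- The names of variables as indices. -/
noncomputable def varIdx : ℕ × Idx κ ≃ Idx κ := Classical.choice <| by
  rw [← Cardinal.lift_mk_eq'] 
  simp [Cardinal.aleph0_mul_eq hκ.out.le]

variable {L : Language.{u}}

/-- The number of a node. -/
noncomputable def numOf (N : Idx κ → Node L κ) (n : Node L κ) : Idx κ := Function.invFun N n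

theorem numOf_spec {N : Idx κ → Node L κ} {n : Node L κ} (h : n ∈ Set.range N) :
    N (numOf N n) = n := Function.invFun_eq h

namespace Node

/-- The type of a node. -/
def tg : Node L κ → Option (Fin 9)
  | @term _ _ _X _Γ _ (.var _) _ => some 0
  | term (.app _ _) _ => some 1
  | fn _ => some 2
  | rl _ => none
  | form (.eq _ _) _ _ => some 3
  | form (.mem _ _) _ _ => some 4
  | form (.rel _ _) _ _ => some 5
  | form (.neg _) _ _ => some 6
  | form (.conj _) _ _ => some 7
  | form (.all _ _) _ _ => some 8

/-- The main constituent of a node. -/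
noncomputable def hd (N : Idx κ → Node L κ) : Node L κ → Idx κ
  | @term _ _ _X _Γ _ (.var x) e => varIdx (e x)
  | term (.app f _) _ => numOf N (fn f)
  | fn _ => Idx.omega
  | rl _ => Idx.omega
  | form (.eq t _) _ e => numOf N (term t e)
  | form (.mem _ A) _ e => numOf N (term A e)
  | form (.rel r _) _ _ => numOf N (rl r)
  | form (.neg φ) d e => numOf N (form φ d e)
  | form (.conj _) _ _ => Idx.omega
  | form (.all _ φ) d e => numOf N (form φ (d + 1) (bind d e))

/-- The number of arguments of a node, or its kind, or its second constituent. -/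
noncomputable def ln (N : Idx κ → Node L κ) : Node L κ → Idx κ
  | @term _ _ _X Γ _ (.var x) _ => kindIdx (Γ x)
  | term (.app f _) _ => lenOf (L.FnArity f)
  | fn f => kindIdx (L.fnOut f)
  | rl _ => Idx.omega
  | form (.eq _ s) _ e => numOf N (term s e)
  | form (.mem (n := n) _ _) _ _ => Idx.nat n
  | form (.rel r _) _ _ => lenOf (L.RlArity r)
  | form (.neg _) _ _ => Idx.omega
  | form (.conj (I := I) _) _ _ => lenOf I
  | form (.all (Y := Y) _ _) _ _ => lenOf Y

/-- The arguments of a node. -/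
noncomputable def ar (N : Idx κ → Node L κ) : Node L κ → Idx κ → Idx κ
  | term (.app f ts) e =>
    -- The default `Idx.omega` is harmless: the clauses read arguments only at indices below the
    -- length recorded by `ln`.
    Function.extend (ixOf (L.FnArity f)) (fun i => numOf N (term (ts i) e)) fun _ => Idx.omega
  | form (.mem (n := n) ts _) _ e =>
    Function.extend (fun i : Fin n => Idx.nat (κ := κ) i) (fun i => numOf N (term (ts i) e))
      fun _ => Idx.omega
  | form (.rel r ts) _ e =>
    Function.extend (ixOf (L.RlArity r)) (fun i => numOf N (term (ts i) e)) fun _ => Idx.omega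
  | form (.conj (I := I) φ) d e =>
    Function.extend (ixOf I) (fun i => numOf N (form (φ i) d e)) fun _ => Idx.omega
  | form (.all (Y := Y) _ _) d _ =>
    Function.extend (ixOf Y) (fun y => varIdx (d, ixOf Y y)) fun _ => Idx.omega
  | _ => fun _ => Idx.omega

/-- The kinds of the variables bound at a node. -/
noncomputable def kn : Node L κ → Idx κ → Idx κ
  | form (.all (Y := Y) Δ _) _ _ =>
    Function.extend (ixOf Y) (fun y => kindIdx (Δ y)) fun _ => Idx.omega
  | _ => fun _ => Idx.omega

/-- The syntactic data of a numbering of nodes. -/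
noncomputable def coding (N : Idx κ → Node L κ) (rt : Idx κ → Idx κ) : Coding κ where
  tg ξ := (N ξ).tg
  hd ξ := (N ξ).hd N
  ln ξ := (N ξ).ln N
  ar ξ := (N ξ).ar N
  kn ξ := (N ξ).kn
  rt := rt

end Node

end Table

/-! ### The clauses of `Table.Models` at the nodes numbered by ordinals below `κ` -/

section Reads

variable {κ : Cardinal.{u}} [hκ : Fact (ℵ₀ < κ)] {C : Coding κ} {t : Table ZFSet.{u}}
  (R : C.Reads t) {M O V S l : ZFSet.{u}} {ξ : Idx κ}
include R

namespace Coding.Reads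

/-- Graphs are functional at indices below κ with values below κ, even if t is larger than the
original table. Each quantifier that looks up a value thus collapses to one instance. -/
theorem forall_hd {P : ZFSet.{u} → Prop} :
    (∀ x ∈ t.K, pair ξ.set x ∈ t.hd → P x) ↔ P (C.hd ξ).set :=
  ⟨fun h => h _ (R.K _) ((R.hd _ _).2 rfl), fun h _ _ hx => (R.hd _ _).1 hx ▸ h⟩

theorem forall_ln {P : ZFSet.{u} → Prop} :
    (∀ x ∈ t.K, pair ξ.set x ∈ t.ln → P x) ↔ P (C.ln ξ).set :=
  ⟨fun h => h _ (R.K _) ((R.ln _ _).2 rfl), fun h _ _ hx => (R.ln _ _).1 hx ▸ h⟩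

theorem forall_ar {i : Idx κ} {P : ZFSet.{u} → Prop} :
    (∀ x ∈ t.K, pair ξ.set (pair i.set x) ∈ t.ar → P x) ↔ P (C.ar ξ i).set :=
  ⟨fun h => h _ (R.K _) ((R.ar _ _ _).2 rfl), fun h _ _ hx => (R.ar _ _ _).1 hx ▸ h⟩

theorem forall_kn {i : Idx κ} {P : ZFSet.{u} → Prop} :
    (∀ x ∈ t.K, pair ξ.set (pair i.set x) ∈ t.kn → P x) ↔ P (C.kn ξ i).set :=
  ⟨fun h => h _ (R.K _) ((R.kn _ _ _).2 rfl), fun h _ _ hx => (R.kn _ _ _).1 hx ▸ h⟩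

variable {I : Type*} {ix : I → Idx κ} (hl : ∀ x, x ∈ l ↔ ∃ a, (ix a).set = x)
  {arg : I → Idx κ} (har : ∀ a, C.ar ξ (ix a) = arg a)
include hl har

theorem match_iff {v w : ZFSet.{u}} : t.Match O V ξ.set l v w ↔
    ∀ a, ∀ b ∈ O, pair (ix a).set b ∈ w → pair (arg a).set (pair v b) ∈ V := by
  simp only [Table.Match, hl, forall_exists_index, forall_apply_eq_imp_iff, R.forall_ar, har]

theorem agree_iff {v w : ZFSet.{u}} : t.Agree O ξ.set l v w ↔
    ∀ x ∈ t.K, (∀ a, (arg a).set ≠ x) → ∀ b ∈ O, pair x b ∈ v → pair x b ∈ w := by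
  simp only [Table.Agree, hl, forall_exists_index, forall_apply_eq_imp_iff, R.forall_ar, har,
    ne_eq]

theorem typed_iff {k : I → Idx κ} (hk : ∀ a, C.kn ξ (ix a) = k a) {w : ZFSet.{u}} :
    t.Typed M O ξ.set l w ↔
      ∀ a, ∃ b ∈ O, pair (arg a).set b ∈ w ∧ IsKind t.om M (k a).set b := by
  simp only [Table.Typed, hl, forall_exists_index, forall_apply_eq_imp_iff, R.forall_ar, har,
    R.forall_kn, hk]

end Coding.Reads

end Reads

section Clauses

variable {κ : Cardinal.{u}} [hκ : Fact (ℵ₀ < κ)] {L : Language.{u}} {N : Idx κ → Node L κ}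
  {rt : Idx κ → Idx κ} {t : Table ZFSet.{u}} (R : (Node.coding N rt).Reads t)
  {M O V S : ZFSet.{u}} {ξ : Idx κ} {X : Type u} {Γ : X → Kind.{u}} {e : X → ℕ × Idx κ}
include R

namespace Node

/-- Here and in the companion lemmas, t is any table that reads the coding. The same reformulation
thus serves the original table when a structure is encoded and the image under j when one is
decoded. -/
theorem varClause_iff {x : X} (h : N ξ = term (.var x : Term L Γ (Γ x)) e) :
    t.VarClause M O V ξ.set ↔ ∀ v, IsFunc t.K O v → ∀ a ∈ O,
      IsKind t.om M (kindIdx (κ := κ) (Γ x)).set a → pair (varIdx (e x)).set a ∈ v →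
        ∀ b ∈ O, (pair ξ.set (pair v b) ∈ V ↔ b = a) := by
  rw [Table.VarClause, R.forall_hd, R.forall_ln]
  simp only [coding, h, hd, ln]

theorem appClause_iff (hL : L.ArityLT κ) {f : L.Fn}
    {ts : (i : L.FnArity f) → Term L Γ (L.fnIn f i)} (h : N ξ = term (.app f ts) e) :
    t.AppClause O V ξ.set ↔ ∀ v, IsFunc t.K O v → ∀ u, IsFunc t.K O u →
      (∀ i, ∀ b ∈ O, pair (ixOf (κ := κ) _ i).set b ∈ u →
        pair (numOf N (term (ts i) e)).set (pair v b) ∈ V) →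
      ∀ a ∈ O, (pair ξ.set (pair v a) ∈ V ↔ pair (numOf N (fn f)).set (pair u a) ∈ V) := by
  rw [Table.AppClause, R.forall_hd, R.forall_ln]
  have hl : ∀ x, x ∈ ((coding N rt).ln ξ).set ↔ ∃ i, (ixOf (κ := κ) (L.FnArity f) i).set = x :=
    fun x => by simp only [coding, h, ln]; exact mem_set_lenOf (hL.1 f)
  have har : ∀ i, (coding N rt).ar ξ (ixOf (L.FnArity f) i) = numOf N (term (ts i) e) := fun i => by
    simp only [coding, h, ar]; exact (ixOf_injective (hL.1 f)).extend_apply _ _ _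
  simp only [R.match_iff hl har]
  simp only [coding, h, hd]

theorem fnClause_iff {f : L.Fn} (h : N ξ = fn f) :
    t.FnClause M O V ξ.set ↔ ∀ u, IsFunc t.K O u →
      ∃ a ∈ O, IsKind t.om M (kindIdx (κ := κ) (L.fnOut f)).set a ∧
        ∀ b ∈ O, (pair ξ.set (pair u b) ∈ V ↔ b = a) := by
  rw [Table.FnClause, R.forall_ln]
  simp only [coding, h, ln]

theorem eqClause_iff {d : ℕ} {k : Kind.{u}} {r s : Term L Γ k} (h : N ξ = form (.eq r s) d e) :
    t.EqClause O V S ξ.set ↔ ∀ v, IsFunc t.K O v → (pair ξ.set v ∈ S ↔ ∃ a ∈ O,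
      pair (numOf N (term r e)).set (pair v a) ∈ V ∧
        pair (numOf N (term s e)).set (pair v a) ∈ V) := by
  rw [Table.EqClause, R.forall_hd, R.forall_ln]
  simp only [coding, h, hd, ln]

theorem memClause_iff {d n : ℕ} {ts : Fin n → Term L Γ Kind.ind} {A : Term L Γ (Kind.set n)}
    (h : N ξ = form (.mem ts A) d e) :
    t.MemClause O V S ξ.set ↔ ∀ v, IsFunc t.K O v → (pair ξ.set v ∈ S ↔ ∃ a ∈ O,
      pair (numOf N (term A e)).set (pair v a) ∈ V ∧ ∃ u ∈ a,
        ∀ i : Fin n, ∀ b ∈ O, pair (Idx.nat (κ := κ) i).set b ∈ u →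
          pair (numOf N (term (ts i) e)).set (pair v b) ∈ V) := by
  rw [Table.MemClause, R.forall_hd, R.forall_ln]
  have hl : ∀ x, x ∈ ((coding N rt).ln ξ).set ↔ ∃ i : Fin n, (Idx.nat (κ := κ) i).set = x :=
    fun x => by simp only [coding, h, ln]; exact Idx.mem_set_nat
  have har : ∀ i : Fin n, (coding N rt).ar ξ (Idx.nat i) = numOf N (term (ts i) e) := fun i => by
    simp only [coding, h, ar]
    exact Function.Injective.extend_apply (f := fun i : Fin n => Idx.nat (κ := κ) i)
      (fun i j h => Fin.ext (Idx.nat_injective h)) _ _ i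
  simp only [R.match_iff hl har]
  simp only [coding, h, hd]

theorem relClause_iff (hL : L.ArityLT κ) {d : ℕ} {r : L.Rl}
    {ts : (i : L.RlArity r) → Term L Γ (L.rlIn r i)} (h : N ξ = form (.rel r ts) d e) :
    t.RelClause O V S ξ.set ↔ ∀ v, IsFunc t.K O v → ∀ u, IsFunc t.K O u →
      (∀ i, ∀ b ∈ O, pair (ixOf (κ := κ) _ i).set b ∈ u →
        pair (numOf N (term (ts i) e)).set (pair v b) ∈ V) →
      (pair ξ.set v ∈ S ↔ pair (numOf N (rl r)).set u ∈ S) := by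
  rw [Table.RelClause, R.forall_hd, R.forall_ln]
  have hl : ∀ x, x ∈ ((coding N rt).ln ξ).set ↔ ∃ i, (ixOf (κ := κ) (L.RlArity r) i).set = x :=
    fun x => by simp only [coding, h, ln]; exact mem_set_lenOf (hL.2 r)
  have har : ∀ i, (coding N rt).ar ξ (ixOf (L.RlArity r) i) = numOf N (term (ts i) e) := fun i => by
    simp only [coding, h, ar]; exact (ixOf_injective (hL.2 r)).extend_apply _ _ _
  simp only [R.match_iff hl har]
  simp only [coding, h, hd]

theorem negClause_iff {d : ℕ} {φ : Formula L Γ} (h : N ξ = form (.neg φ) d e) :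
    t.NegClause O S ξ.set ↔ ∀ v, IsFunc t.K O v →
      (pair ξ.set v ∈ S ↔ ¬ pair (numOf N (form φ d e)).set v ∈ S) := by
  rw [Table.NegClause, R.forall_hd]
  simp only [coding, h, hd]

theorem conjClause_iff {d : ℕ} {I : Type u} (hI : #I < κ) {φ : I → Formula L Γ}
    (h : N ξ = form (.conj φ) d e) :
    t.ConjClause O S ξ.set ↔ ∀ v, IsFunc t.K O v →
      (pair ξ.set v ∈ S ↔ ∀ i, pair (numOf N (form (φ i) d e)).set v ∈ S) := by
  rw [Table.ConjClause, R.forall_ln]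
  have : (coding N rt).ln ξ = lenOf I := by simp only [coding, h, ln]
  simp only [this, mem_set_lenOf hI, forall_exists_index, forall_apply_eq_imp_iff, R.forall_ar]
  simp only [coding, h, ar, (ixOf_injective hI).extend_apply]

theorem allClause_iff {d : ℕ} {Y : Type u} (hY : #Y < κ) {Δ : Y → Kind.{u}}
    {φ : Formula L (Sum.elim Γ Δ)} (h : N ξ = form (.all Δ φ) d e) :
    t.AllClause M O S ξ.set ↔ ∀ v, IsFunc t.K O v →
      (pair ξ.set v ∈ S ↔ ∀ w, IsFunc t.K O w →
        (∀ x ∈ t.K, (∀ y, (varIdx (κ := κ) (d, ixOf Y y)).set ≠ x) →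
          ∀ b ∈ O, pair x b ∈ v → pair x b ∈ w) →
        (∀ y, ∃ b ∈ O, pair (varIdx (κ := κ) (d, ixOf Y y)).set b ∈ w ∧
          IsKind t.om M (kindIdx (κ := κ) (Δ y)).set b) →
        pair (numOf N (form φ (d + 1) (bind d e))).set w ∈ S) := by
  rw [Table.AllClause, R.forall_hd, R.forall_ln]
  have hl : ∀ x, x ∈ ((coding N rt).ln ξ).set ↔ ∃ y, (ixOf (κ := κ) Y y).set = x := fun x => by
    simp only [coding, h, ln]; exact mem_set_lenOf hY
  have har : ∀ y, (coding N rt).ar ξ (ixOf Y y) = varIdx (d, ixOf Y y) := fun y => by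
    simp only [coding, h, ar]; exact (ixOf_injective hY).extend_apply _ _ _
  have hkn : ∀ y, (coding N rt).kn ξ (ixOf Y y) = kindIdx (Δ y) := fun y => by
    simp only [coding, h, kn]; exact (ixOf_injective hY).extend_apply _ _ _
  simp only [R.agree_iff hl har, R.typed_iff hl har hkn]
  simp only [coding, h, hd]

end Node

end Clauses

/-! ### Coding a structure -/

instance Kind.nonempty_obj {M : Type u} [Nonempty M] (k : Kind.{u}) : Nonempty (k.Obj M) := by
  cases k
  · assumption
  · exact ⟨(∅ : Set _)⟩

/-- The value of a set-theoretic function. -/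
noncomputable def funVal (v x : ZFSet.{u}) : ZFSet.{u} := Classical.epsilon fun a => pair x a ∈ v

theorem pair_mem_iff_eq_funVal {K O v x a : ZFSet.{u}} (hv : IsFunc K O v) (hx : x ∈ K) :
    pair x a ∈ v ↔ a = funVal v x := by
  have h := Classical.epsilon_spec (hv.2 x hx).exists
  constructor
  · exact fun h' => (hv.2 x hx).unique h' h
  · rintro rfl
    exact h

theorem funVal_mem {K O v x : ZFSet.{u}} (hv : IsFunc K O v) (hx : x ∈ K) : funVal v x ∈ O :=
  (pair_mem_prod.1 (hv.1 ((pair_mem_iff_eq_funVal hv hx).2 rfl))).2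

/-- The set-theoretic function with given values. -/
noncomputable def mkFun (K : ZFSet.{u}) (g : ZFSet.{u} → ZFSet.{u}) : ZFSet.{u} :=
  range fun x : K => pair x.1 (g x)

theorem pair_mem_mkFun {K x a : ZFSet.{u}} {g : ZFSet.{u} → ZFSet.{u}} (hx : x ∈ K) :
    pair x a ∈ mkFun K g ↔ a = g x := by
  rw [mkFun, mem_range]
  constructor
  · rintro ⟨y, hy⟩
    obtain ⟨rfl, rfl⟩ := pair_inj.1 hy
    rfl
  · rintro rfl
    exact ⟨⟨x, hx⟩, rfl⟩

theorem isFunc_mkFun {K O : ZFSet.{u}} {g : ZFSet.{u} → ZFSet.{u}} (hg : ∀ x ∈ K, g x ∈ O) :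
    IsFunc K O (mkFun K g) := by
  refine ⟨fun z hz => ?_, fun x hx => ⟨g x, (pair_mem_mkFun hx).2 rfl, fun y hy =>
    (pair_mem_mkFun hx).1 hy⟩⟩
  obtain ⟨x, rfl⟩ := mem_range.1 hz
  exact pair_mem_prod.2 ⟨x.2, hg _ x.2⟩

section Encode

variable (κ : Cardinal.{u}) [hκ : Fact (ℵ₀ < κ)] {L : Language.{u}} {M : Type u} [Nonempty M]
  (A : Interp L M) (b : M → ZFSet.{u})

/-- The object with a given code. -/
noncomputable def decode (k : Kind.{u}) : ZFSet.{u} → k.Obj M := Function.invFun (code κ b k)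

variable {κ}

/-- The assignment coded by `v`. -/
noncomputable def decodeAssign {X : Type u} (Γ : X → Kind.{u}) (e : X → ℕ × Idx κ) (v : ZFSet.{u})
    (x : X) : (Γ x).Obj M :=
  decode κ b (Γ x) (funVal v (varIdx (e x)).set)

variable (κ) in
/-- The list of arguments of a symbol coded by `u`. -/
noncomputable def decodeArgs {I : Type u} (Γ : I → Kind.{u}) (u : ZFSet.{u}) (i : I) :
    (Γ i).Obj M :=
  decode κ b (Γ i) (funVal u (ixOf (κ := κ) I i).set)

/-- The code of the value of a term or function symbol. -/
noncomputable def Node.val : Node L κ → ZFSet.{u} → ZFSet.{u}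
  | term (Γ := Γ) (k := k) t e, v => code κ b k (t.val A (decodeAssign b Γ e v))
  | fn f, u => code κ b _ (A.fn f (decodeArgs κ b _ u))
  | _, _ => ∅

/-- The truth of a formula or relation symbol. -/
def Node.Sat : Node L κ → ZFSet.{u} → Prop
  | form (Γ := Γ) φ _ e, v => φ.Holds A (decodeAssign b Γ e v)
  | rl r, u => A.rl r (decodeArgs κ b _ u)
  | _, _ => False

/-- The set that codes the values of terms. -/
noncomputable def valSet (N : Idx κ → Node L κ) (O : ZFSet.{u}) : ZFSet.{u} :=
  (prod κ.ord.toZFSet (prod (funs κ.ord.toZFSet O) O)).sep fun z =>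
    ∃ ξ v, z = pair ξ.set (pair v ((N ξ).val A b v))

/-- The set that codes the truth of formulas. -/
noncomputable def satSet (N : Idx κ → Node L κ) (O : ZFSet.{u}) : ZFSet.{u} :=
  (prod κ.ord.toZFSet (funs κ.ord.toZFSet O)).sep fun z =>
    ∃ ξ v, z = pair ξ.set v ∧ (N ξ).Sat A b v

variable {A b} {N : Idx κ → Node L κ} {M₀ O : ZFSet.{u}} {ξ : Idx κ} {v a : ZFSet.{u}}

theorem mem_valSet (hv : IsFunc κ.ord.toZFSet O v) (ha : a ∈ O) :
    pair ξ.set (pair v a) ∈ valSet A b N O ↔ a = (N ξ).val A b v := by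
  simp only [valSet, ZFSet.mem_sep, pair_mem_prod, mem_funs, hv, ha, and_true, pair_inj,
    Idx.set_inj, mem_toZFSet_ord, exists_eq, true_and]
  constructor
  · rintro ⟨_, _, rfl, rfl, rfl⟩
    rfl
  · exact fun h => ⟨_, _, rfl, rfl, h⟩

theorem mem_satSet (hv : IsFunc κ.ord.toZFSet O v) :
    pair ξ.set v ∈ satSet A b N O ↔ (N ξ).Sat A b v := by
  simp only [satSet, ZFSet.mem_sep, pair_mem_prod, mem_funs, hv, and_true, pair_inj,
    Idx.set_inj, mem_toZFSet_ord, exists_eq, true_and]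
  constructor
  · rintro ⟨_, _, ⟨rfl, rfl⟩, h⟩
    exact h
  · exact fun h => ⟨_, _, ⟨rfl, rfl⟩, h⟩

variable (hb : Function.Injective b)

include hb in
theorem decode_code {k : Kind.{u}} (o : k.Obj M) : decode κ b k (code κ b k o) = o :=
  Function.leftInverse_invFun (code_injective hb k) o

variable (hM : ∀ x, x ∈ M₀ ↔ ∃ m, b m = x) (hO : ∀ (k : Kind.{u}) o, code κ b k o ∈ O)
  (hL : L.ArityLT κ) (hN : ∀ ξ, (N ξ).Ok) (hN' : ∀ ξ, (N ξ).kids ⊆ Set.range N)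

omit [Nonempty M] in
include hM hO in
theorem full_of_code (C : Coding κ) [Nonempty M] : C.table.Full M₀ O := by
  obtain ⟨m⟩ := ‹Nonempty M›
  refine ⟨⟨b m, (hM _).2 ⟨m, rfl⟩, rfl⟩, fun a ha => ?_, fun n hn B hB => ?_⟩
  · obtain ⟨m, rfl⟩ := (hM _).1 ha
    exact hO .ind m
  · obtain ⟨n, rfl⟩ := Idx.mem_set_omega.1 hn
    obtain ⟨o, rfl⟩ := (isKind_iff (κ := κ) hM (k := .set n)).1
      (Or.inl ⟨Idx.mem_set_omega.2 ⟨n, rfl⟩, hB⟩)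
    exact hO _ o

include hb hM hO hL hN hN' in
-- V and S record the true values and truth under decoded assignments, so each clause is the
-- corresponding step of Tarski's definition. Ill-typed entries decode to arbitrary objects, which
-- the clauses tolerate.
theorem models_of_holds {rt : Idx κ → Idx κ} {α : Idx κ}
    (hα : ∀ i < α, ∀ v, (N (rt i)).Sat A b v) :
    (Node.coding N rt).table.Models M₀ O (valSet A b N O) (satSet A b N O) α.set := by
  have R := (Node.coding N rt).reads_table
  have hkid : ∀ {ξ n m}, N ξ = m → n ∈ m.kids → N (numOf N n) = n := fun h hn =>
    numOf_spec (hN' _ (h ▸ hn))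
  have hKset : ∀ i : Idx κ, i.set ∈ κ.ord.toZFSet := fun i => mem_toZFSet_ord.2 ⟨i, rfl⟩
  have hform : ∀ n : Fin 9, ∀ P : ZFSet.{u} → Prop, (∀ ξ : Idx κ, (N ξ).tg = some n → P ξ.set) →
      ∀ x ∈ (Node.coding N rt).table.K, x ∈ (Node.coding N rt).table.tg n → P x := by
    intro n P h x hx hx'
    obtain ⟨ξ, rfl⟩ := mem_toZFSet_ord.1 hx
    exact h ξ ((R.tg _ _).1 hx')
  refine ⟨full_of_code hM hO _, ?_, hform _ _ ?_, hform _ _ ?_, hform _ _ ?_, hform _ _ ?_,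
    hform _ _ ?_, hform _ _ ?_, hform _ _ ?_, hform _ _ ?_, hform _ _ ?_⟩
  · intro x hx η _ hη v hv
    obtain ⟨i, hi, rfl⟩ := Idx.mem_set.1 hx
    obtain rfl := (R.rt _ _).1 hη
    exact (mem_satSet hv).2 (hα i hi v)
  all_goals
    intro ξ hξ
    rcases h : N ξ with ⟨t, e⟩ | f | r | ⟨φ, d, e⟩
    all_goals first | cases t | cases φ | skip
    all_goals first | (exfalso; simp [h, Node.tg] at hξ; done) | skip
  · rename_i x
    rw [Node.varClause_iff R h]
    intro v hv a ha hk hav c hc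
    obtain ⟨o, rfl⟩ := (isKind_iff hM).1 hk
    rw [mem_valSet hv hc, h, Node.val, Term.val, decodeAssign,
      ← (pair_mem_iff_eq_funVal hv (hKset _)).1 hav, decode_code hb]
  · rename_i f ts
    rw [Node.appClause_iff R hL h]
    intro v hv u hu hm a ha
    rw [mem_valSet hv ha, mem_valSet hu ha, hkid h (Or.inl rfl), h, Node.val, Node.val, Term.val]
    have : decodeArgs κ b (L.fnIn f) u = fun i => (ts i).val A (decodeAssign b _ e v) := by
      funext i
      have h1 := hm i _ (funVal_mem hu (hKset _)) ((pair_mem_iff_eq_funVal hu (hKset _)).2 rfl)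
      rw [mem_valSet hv (funVal_mem hu (hKset _)), hkid h (Or.inr ⟨i, rfl⟩)] at h1
      rw [decodeArgs, h1, Node.val, decode_code hb]
    rw [this]
  · rw [Node.fnClause_iff R h]
    intro u hu
    exact ⟨_, hO _ _, (isKind_iff hM).2 ⟨_, rfl⟩, fun c hc => by
      rw [mem_valSet hu hc, h, Node.val]⟩
  · rename_i k r s
    rw [Node.eqClause_iff R h]
    intro v hv
    have h1 := hkid (n := .term r e) h (Or.inl rfl)
    have h2 := hkid (n := .term s e) h (Or.inr rfl)
    rw [mem_satSet hv, h, Node.Sat, Formula.Holds]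
    constructor
    · intro he
      refine ⟨_, hO k (r.val A (decodeAssign b _ e v)), (mem_valSet hv (hO _ _)).2 ?_,
        (mem_valSet hv (hO _ _)).2 ?_⟩
      · rw [h1, Node.val]
      · rw [h2, Node.val, he]
    · rintro ⟨a, ha, h3, h4⟩
      rw [mem_valSet hv ha, h1, Node.val] at h3
      rw [mem_valSet hv ha, h2, Node.val] at h4
      exact code_injective hb _ (h3.symm.trans h4)
  · rename_i n ts B
    rw [Node.memClause_iff R h]
    intro v hv
    have h1 := hkid (n := .term B e) h (Or.inl rfl)
    have h2 := fun i => hkid (n := .term (ts i) e) h (Or.inr ⟨i, rfl⟩)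
    rw [mem_satSet hv, h, Node.Sat]
    let w : Fin n → M := fun i => (ts i).val A (decodeAssign b _ e v)
    -- Matching determines the tuple: only the tuple of values of the argument terms can match.
    have key : ∀ u : Fin n → M, (∀ i : Fin n, ∀ c ∈ O, pair (Idx.nat (κ := κ) i).set c ∈
        tupleCode κ b u → pair (numOf N (Node.term (ts i) e)).set (pair v c) ∈ valSet A b N O) ↔
        w = u := by
      intro u
      refine Iff.trans (forall_congr' fun i => ?_) funext_iff.symm
      simp only [pair_mem_tupleCode]
      have : b (u i) ∈ O := hO .ind (u i)
      constructor
      · intro h3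
        have h4 := h3 _ this rfl
        rw [mem_valSet hv this, h2, Node.val] at h4
        exact (hb h4).symm
      · rintro h3 c hc rfl
        rw [mem_valSet hv this, h2, Node.val, ← h3]
        rfl
    constructor
    · intro he
      refine ⟨_, hO (.set n) (B.val A (decodeAssign b _ e v)), (mem_valSet hv (hO _ _)).2
        (by rw [h1, Node.val]), tupleCode κ b _, (tupleCode_mem_code hb).2 he, (key _).2 rfl⟩
    · rintro ⟨a, ha, h3, u, hu, h4⟩
      rw [mem_valSet hv ha, h1, Node.val] at h3
      obtain rfl := h3
      obtain ⟨u, hu', rfl⟩ := mem_code_set.1 hu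
      rw [key] at h4
      subst h4
      exact hu'
  · rename_i r ts
    rw [Node.relClause_iff R hL h]
    intro v hv u hu hm
    rw [mem_satSet hv, mem_satSet hu, hkid h (Or.inl rfl), h, Node.Sat, Node.Sat, Formula.Holds]
    have : decodeArgs κ b (L.rlIn r) u = fun i => (ts i).val A (decodeAssign b _ e v) := by
      funext i
      have h1 := hm i _ (funVal_mem hu (hKset _)) ((pair_mem_iff_eq_funVal hu (hKset _)).2 rfl)
      rw [mem_valSet hv (funVal_mem hu (hKset _)), hkid h (Or.inr ⟨i, rfl⟩)] at h1
      rw [decodeArgs, h1, Node.val, decode_code hb]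
    rw [this]
  · rw [Node.negClause_iff R h]
    intro v hv
    rw [mem_satSet hv, mem_satSet hv, hkid h rfl, h]
    rfl
  · rw [Node.conjClause_iff R (h ▸ hN ξ).1.1 h]
    intro v hv
    rw [mem_satSet hv, h]
    refine forall_congr' fun i => ?_
    rw [mem_satSet hv, hkid h ⟨i, rfl⟩]
    rfl
  · rename_i X Γ Y Δ φ
    have hok : (Node.form (.all Δ φ) d e).Ok := h ▸ hN ξ
    rw [Node.allClause_iff R hok.1.1 h]
    intro v hv
    -- Bound names have depth d, free names smaller depth, so reassigning the former leaves the
    -- latter alone.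
    have hne : ∀ (x : X) (y : Y), (varIdx (κ := κ) (d, ixOf Y y)).set ≠ (varIdx (e x)).set := by
      intro x y hxy
      rw [Idx.set_inj, varIdx.injective.eq_iff] at hxy
      exact (hok.2 x).ne (congrArg Prod.fst hxy).symm
    rw [mem_satSet hv, h, Node.Sat, Formula.Holds]
    constructor
    · intro hall w hw hvw _
      rw [mem_satSet hw, hkid h rfl, Node.Sat]
      convert hall (fun y => decode κ b (Δ y) (funVal w (varIdx (d, ixOf Y y)).set)) using 1
      funext z
      rcases z with x | y
      · have := (pair_mem_iff_eq_funVal hw (hKset _)).1 (hvw _ (hKset _) (hne x) _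
          (funVal_mem hv (hKset _)) ((pair_mem_iff_eq_funVal hv (hKset _)).2 rfl))
        simp only [decodeAssign, extend, Node.bind, Sum.elim_inl]
        rw [this]
      · rfl
    · intro hall w'
      classical
      -- The assignment v, overwritten at the bound names by the codes of the given objects.
      let g : ZFSet.{u} → ZFSet.{u} := fun x =>
        if hx : ∃ y, (varIdx (κ := κ) (d, ixOf Y y)).set = x then code κ b _ (w' hx.choose)
        else funVal v x
      have hgO : ∀ x ∈ κ.ord.toZFSet, g x ∈ O := by
        intro x hx
        by_cases h' : ∃ y, (varIdx (κ := κ) (d, ixOf Y y)).set = x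
        · simp only [g, dif_pos h']
          exact hO _ _
        · simp only [g, dif_neg h']
          exact funVal_mem hv hx
      have hgy : ∀ y, g (varIdx (κ := κ) (d, ixOf Y y)).set = code κ b _ (w' y) := by
        intro y
        have h' : ∃ y', (varIdx (κ := κ) (d, ixOf Y y')).set = (varIdx (d, ixOf Y y)).set :=
          ⟨y, rfl⟩
        have h2 := h'.choose_spec
        rw [Idx.set_inj, varIdx.injective.eq_iff, Prod.mk.injEq,
          (ixOf_injective hok.1.1).eq_iff] at h2
        simp only [g, dif_pos h']
        rw [h2.2]
      have hgx : ∀ x, (∀ y, (varIdx (κ := κ) (d, ixOf Y y)).set ≠ x) → g x = funVal v x := by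
        intro x hx
        have h' : ¬ ∃ y, (varIdx (κ := κ) (d, ixOf Y y)).set = x := by simpa using hx
        simp only [g, dif_neg h']
      have hw := isFunc_mkFun hgO
      have h1 := hall _ hw ?_ ?_
      · rw [mem_satSet hw, hkid h rfl, Node.Sat] at h1
        convert h1 using 1
        funext z
        have hz : ∀ i : Idx κ, funVal (mkFun κ.ord.toZFSet g) i.set = g i.set := fun i =>
          ((pair_mem_mkFun (hKset i)).1 ((pair_mem_iff_eq_funVal hw (hKset _)).2 rfl))
        rcases z with x | y
        · simp only [decodeAssign, extend, Node.bind, Sum.elim_inl, hz, hgx _ (hne x)]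
        · simp only [decodeAssign, extend, Node.bind, Sum.elim_inr, hz, hgy]
          exact (decode_code hb _).symm
      · intro x hx hx' c hc hcv
        rw [(pair_mem_iff_eq_funVal hv hx).1 hcv]
        exact (pair_mem_mkFun hx).2 (hgx x hx').symm
      · intro y
        exact ⟨_, hO _ (w' y), (pair_mem_mkFun (hKset _)).2 (hgy y).symm,
          (isKind_iff hM).2 ⟨_, rfl⟩⟩

end Encode

/-! ### Decoding a structure -/

section Decode

variable {κ : Cardinal.{u}} [hκ : Fact (ℵ₀ < κ)] {L : Language.{u}} {M : Type u}
  {b : M → ZFSet.{u}} {t : Table ZFSet.{u}} {M₀ O V S : ZFSet.{u}} {N : Idx κ → Node L κ}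

variable (κ b) in
/-- The set-theoretic function coding a list of arguments. -/
noncomputable def argFun (K o : ZFSet.{u}) {I : Type u} {Γ : I → Kind.{u}}
    (a : (i : I) → (Γ i).Obj M) : ZFSet.{u} :=
  mkFun K (Function.extend (fun i => (ixOf (κ := κ) I i).set) (fun i => code κ b _ (a i))
    fun _ => o)

theorem code_mem_of_full (hM : ∀ x, x ∈ M₀ ↔ ∃ m, b m = x) (hom : t.om = (Idx.omega (κ := κ)).set)
    (h : t.Full M₀ O) (k : Kind.{u}) (o : k.Obj M) : code κ b k o ∈ O := by
  cases k with
  | ind => exact h.2.1 _ ((hM _).2 ⟨o, rfl⟩)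
  | set n =>
    refine h.2.2 (Idx.nat (κ := κ) n).set (hom ▸ Idx.mem_set_omega.2 ⟨n, rfl⟩) _ fun u hu => ?_
    obtain ⟨s, -, rfl⟩ := mem_code_set.1 hu
    exact (isFunc_iff_exists_tuple hM).2 ⟨s, rfl⟩

theorem isFunc_argFun {K o : ZFSet.{u}} (ho : o ∈ O) (hO : ∀ (k : Kind.{u}) o, code κ b k o ∈ O)
    {I : Type u} {Γ : I → Kind.{u}} (a : (i : I) → (Γ i).Obj M) :
    IsFunc K O (argFun κ b K o a) := by
  refine isFunc_mkFun fun x _ => ?_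
  by_cases h : ∃ i, (ixOf (κ := κ) I i).set = x
  · classical
    rw [Function.extend_def, dif_pos h]
    exact hO _ _
  · rw [Function.extend_apply' _ _ _ h]
    exact ho

theorem mem_argFun {K o : ZFSet.{u}} (hK : ∀ i : Idx κ, i.set ∈ K) {I : Type u} (hI : #I < κ)
    {Γ : I → Kind.{u}} {a : (i : I) → (Γ i).Obj M} {i : I} {x : ZFSet.{u}} :
    pair (ixOf (κ := κ) I i).set x ∈ argFun κ b K o a ↔ x = code κ b _ (a i) := by
  rw [argFun, pair_mem_mkFun (hK _),
    Function.Injective.extend_apply (f := fun i => (ixOf (κ := κ) I i).set)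
      (Idx.set_injective.comp (ixOf_injective hI))]

variable [Nonempty M]

theorem code_decode (hM : ∀ x, x ∈ M₀ ↔ ∃ m, b m = x) {k : Kind.{u}} {a : ZFSet.{u}}
    (h : IsKind (Idx.omega (κ := κ)).set M₀ (kindIdx (κ := κ) k).set a) :
    code κ b k (decode κ b k a) = a :=
  Function.invFun_eq ((isKind_iff hM).1 h)

variable (b t O V S N) in
/-- The structure coded by `V` and `S`. -/
noncomputable def decodeInterp (o : ZFSet.{u}) : Interp L M where
  fn f a := decode κ b _ (Classical.epsilon fun c =>
    c ∈ O ∧ pair (numOf N (Node.fn f)).set (pair (argFun κ b t.K o a) c) ∈ V)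
  rl r a := pair (numOf N (Node.rl r)).set (argFun κ b t.K o a) ∈ S

variable (hb : Function.Injective b) (hM : ∀ x, x ∈ M₀ ↔ ∃ m, b m = x)
  {o : ZFSet.{u}} (ho : o ∈ O)
  (hL : L.ArityLT κ) (hN : ∀ ξ, (N ξ).Ok) (hN' : ∀ ξ, (N ξ).kids ⊆ Set.range N)
  {rt : Idx κ → Idx κ} (R : (Node.coding N rt).Reads t) {α : ZFSet.{u}}
  (h : t.Models M₀ O V S α)

include hM ho hL hN' R h in
-- Induction on the term. For an application, `AppClause` is used with the canonical argument list
-- `argFun` of the values of the subterms, the list on which `decodeInterp` defines the symbol.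
theorem mem_val_iff {X : Type u} {Γ : X → Kind.{u}} {e : X → ℕ × Idx κ}
    {v : ZFSet.{u}} (hv : IsFunc t.K O v) {v' : (x : X) → (Γ x).Obj M}
    (hvv : ∀ x, pair (varIdx (e x)).set (code κ b _ (v' x)) ∈ v) {k : Kind.{u}} (s : Term L Γ k) :
    ∀ ξ, N ξ = Node.term s e → ∀ a ∈ O,
      (pair ξ.set (pair v a) ∈ V ↔ a = code κ b k (s.val (decodeInterp b t O V S N o) v')) := by
  have hO := code_mem_of_full hM R.om h.1
  induction s with
  | var x =>
    intro ξ hξ a ha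
    have hc := h.2.2.1 ξ.set (R.K ξ) ((R.tg _ _).2 (by simp only [Node.coding, hξ, Node.tg]))
    rw [Node.varClause_iff R hξ] at hc
    exact hc v hv _ (hO _ _) (R.om ▸ (isKind_iff hM).2 ⟨_, rfl⟩) (hvv x) a ha
  | app f ts ih =>
    intro ξ hξ a ha
    have hkid : ∀ {n}, n ∈ (N ξ).kids → N (numOf N n) = n := fun hn => numOf_spec (hN' _ hn)
    rw [hξ] at hkid
    have hc := h.2.2.2.1 ξ.set (R.K ξ) ((R.tg _ _).2 (by simp only [Node.coding, hξ, Node.tg]))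
    rw [Node.appClause_iff R hL hξ] at hc
    have hf := hkid (Or.inl rfl)
    have hcf := h.2.2.2.2.1 (numOf N (Node.fn f)).set (R.K _)
      ((R.tg _ _).2 (by simp only [Node.coding, hf, Node.tg]))
    rw [Node.fnClause_iff R hf] at hcf
    have hu := isFunc_argFun (K := t.K) ho hO
      fun i => (ts i).val (decodeInterp b t O V S N o) v'
    obtain ⟨c, hcO, hck, hc'⟩ := hcf _ hu
    rw [hc v hv _ hu ?_ a ha, hc' a ha, Term.val]
    -- The interpretation picks a value by choice; uniqueness in `FnClause` identifies it with c.
    · have hs := Classical.epsilon_spec (p := fun c => c ∈ O ∧ pair (numOf N (Node.fn f)).set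
        (pair (argFun κ b t.K o fun i => (ts i).val (decodeInterp b t O V S N o) v') c) ∈ V)
        ⟨c, hcO, (hc' c hcO).2 rfl⟩
      have hs' := (hc' _ hs.1).1 hs.2
      change a = c ↔ a = code κ b _ (decode κ b _ (Classical.epsilon _))
      rw [hs', code_decode hM (R.om ▸ hck)]
    · intro i c hc hci
      rw [mem_argFun R.K (hL.1 f)] at hci
      exact (ih i _ (hkid (Or.inr ⟨i, rfl⟩)) c hc).2 hci

include hb hM ho hL hN hN' R h in
-- Induction on the formula. In the quantifier case, O contains the codes of all objects over M and
-- the clause ranges over all functions from K to O, so S computes full second-order truth. Elements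
-- of t.K outside κ merely occupy unused places in assignments.
theorem mem_sat_iff {X : Type u} {Γ : X → Kind.{u}} (φ : Formula L Γ) :
    ∀ (d : ℕ) (e : X → ℕ × Idx κ) (v : ZFSet.{u}), IsFunc t.K O v →
      ∀ v' : (x : X) → (Γ x).Obj M, (∀ x, pair (varIdx (e x)).set (code κ b _ (v' x)) ∈ v) →
        ∀ ξ, N ξ = Node.form φ d e →
          (pair ξ.set v ∈ S ↔ φ.Holds (decodeInterp b t O V S N o) v') := by
  have hO := code_mem_of_full hM R.om h.1
  have hkid : ∀ {ξ n m}, N ξ = m → n ∈ m.kids → N (numOf N n) = n := fun h hn =>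
    numOf_spec (hN' _ (h ▸ hn))
  have hval := fun {X : Type u} {Γ : X → Kind.{u}} {e : X → ℕ × Idx κ} {v : ZFSet.{u}}
    (hv : IsFunc t.K O v) {v' : (x : X) → (Γ x).Obj M} hvv {k : Kind.{u}} (s : Term L Γ k) {ξ} =>
    mem_val_iff (e := e) hM ho hL hN' R h hv (v' := v') hvv s ξ
  obtain ⟨-, -, -, -, -, c3, c4, c5, c6, c7, c8⟩ := h
  induction φ with
  | eq r s =>
    intro d e v hv v' hvv ξ hξ
    have hc := c3 ξ.set (R.K ξ) ((R.tg _ _).2 (by simp only [Node.coding, hξ, Node.tg]))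
    rw [Node.eqClause_iff R hξ] at hc
    rw [hc v hv, Formula.Holds]
    have h1 := hval hv hvv r (hkid hξ (Or.inl rfl))
    have h2 := hval hv hvv s (hkid hξ (Or.inr rfl))
    constructor
    · rintro ⟨a, ha, h3, h4⟩
      exact code_injective hb _ (((h1 a ha).1 h3).symm.trans ((h2 a ha).1 h4))
    · intro he
      exact ⟨_, hO _ _, (h1 _ (hO _ _)).2 rfl, (h2 _ (hO _ _)).2 (by rw [he])⟩
  | mem ts B =>
    intro d e v hv v' hvv ξ hξ
    have hc := c4 ξ.set (R.K ξ) ((R.tg _ _).2 (by simp only [Node.coding, hξ, Node.tg]))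
    rw [Node.memClause_iff R hξ] at hc
    rw [hc v hv]
    have h1 := hval hv hvv B (hkid hξ (Or.inl rfl))
    have h2 := fun i => hval hv hvv (ts i) (hkid hξ (Or.inr ⟨i, rfl⟩))
    constructor
    · rintro ⟨a, ha, h3, u, hu, h4⟩
      obtain rfl := (h1 a ha).1 h3
      obtain ⟨s, hs, rfl⟩ := mem_code_set.1 hu
      have : s = fun i => (ts i).val (decodeInterp b t O V S N o) v' := funext fun i =>
        hb ((h2 i _ (hO .ind (s i))).1 (h4 i _ (hO .ind (s i)) (pair_mem_tupleCode.2 rfl)))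
      rw [this] at hs
      exact hs
    · intro hB
      refine ⟨_, hO _ _, (h1 _ (hO _ _)).2 rfl, _, (tupleCode_mem_code hb).2 hB,
        fun i c hc hi => (h2 i c hc).2 (pair_mem_tupleCode.1 hi)⟩
  | rel r ts =>
    intro d e v hv v' hvv ξ hξ
    have hc := c5 ξ.set (R.K ξ) ((R.tg _ _).2 (by simp only [Node.coding, hξ, Node.tg]))
    rw [Node.relClause_iff R hL hξ] at hc
    rw [hc v hv _ (isFunc_argFun ho hO
      fun i => (ts i).val (decodeInterp b t O V S N o) v') fun i c hc hi => ?_]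
    · rfl
    · exact (hval hv hvv (ts i) (hkid hξ (Or.inr ⟨i, rfl⟩)) c hc).2
        ((mem_argFun R.K (hL.2 r)).1 hi)
  | neg φ ih =>
    intro d e v hv v' hvv ξ hξ
    have hc := c6 ξ.set (R.K ξ) ((R.tg _ _).2 (by simp only [Node.coding, hξ, Node.tg]))
    rw [Node.negClause_iff R hξ] at hc
    rw [hc v hv, ih d e v hv v' hvv _ (hkid hξ rfl)]
    rfl
  | conj φ ih =>
    intro d e v hv v' hvv ξ hξ
    have hc := c7 ξ.set (R.K ξ) ((R.tg _ _).2 (by simp only [Node.coding, hξ, Node.tg]))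
    rw [Node.conjClause_iff R (hξ ▸ hN ξ).1.1 hξ] at hc
    rw [hc v hv]
    exact forall_congr' fun i => ih i d e v hv v' hvv _ (hkid hξ ⟨i, rfl⟩)
  | @all X Γ Y Δ φ ih =>
    intro d e v hv v' hvv ξ hξ
    have hok : (Node.form (.all Δ φ) d e).Ok := hξ ▸ hN ξ
    have hc := c8 ξ.set (R.K ξ) ((R.tg _ _).2 (by simp only [Node.coding, hξ, Node.tg]))
    rw [Node.allClause_iff R hok.1.1 hξ] at hc
    rw [hc v hv]
    have hne : ∀ (x : X) (y : Y), (varIdx (κ := κ) (d, ixOf Y y)).set ≠ (varIdx (e x)).set := by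
      intro x y hxy
      rw [Idx.set_inj, varIdx.injective.eq_iff] at hxy
      exact (hok.2 x).ne (congrArg Prod.fst hxy).symm
    constructor
    · intro hall w'
      have hinj : Function.Injective fun y => (varIdx (κ := κ) (d, ixOf Y y)).set := by
        intro y y' hy
        rw [Idx.set_inj, varIdx.injective.eq_iff, Prod.mk.injEq] at hy
        exact ixOf_injective hok.1.1 hy.2
      let g : ZFSet.{u} → ZFSet.{u} := Function.extend
        (fun y => (varIdx (κ := κ) (d, ixOf Y y)).set) (fun y => code κ b _ (w' y)) (funVal v)
      have hgy : ∀ y, g (varIdx (d, ixOf Y y)).set = code κ b _ (w' y) := fun y =>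
        hinj.extend_apply _ _ y
      have hgx : ∀ x, (∀ y, (varIdx (κ := κ) (d, ixOf Y y)).set ≠ x) → g x = funVal v x :=
        fun x hx => Function.extend_apply' _ _ _ fun ⟨y, hy⟩ => hx y hy
      have hw : IsFunc t.K O (mkFun t.K g) := isFunc_mkFun fun x hx => by
        by_cases h' : ∃ y, (varIdx (κ := κ) (d, ixOf Y y)).set = x
        · obtain ⟨y, rfl⟩ := h'
          rw [hgy]
          exact hO _ _
        · rw [hgx x fun y hy => h' ⟨y, hy⟩]
          exact funVal_mem hv hx
      refine (ih (d + 1) (Node.bind d e) _ hw (extend v' w') ?_ _ (hkid hξ rfl)).1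
        (hall _ hw ?_ ?_)
      · rintro (x | y)
        · refine (pair_mem_mkFun (R.K _)).2 ?_
          simp only [Node.bind, Sum.elim_inl, hgx _ (hne x)]
          exact (pair_mem_iff_eq_funVal hv (R.K _)).1 (hvv x)
        · exact (pair_mem_mkFun (R.K _)).2 (hgy y).symm
      · intro x hx hx' c hc hcv
        rw [(pair_mem_iff_eq_funVal hv hx).1 hcv]
        exact (pair_mem_mkFun hx).2 (hgx x hx').symm
      · intro y
        exact ⟨_, hO _ (w' y), (pair_mem_mkFun (R.K _)).2 (hgy y).symm,
          R.om ▸ (isKind_iff hM).2 ⟨_, rfl⟩⟩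
    · intro hall w hw hvw hwk
      -- `Typed` supplies entries of the right kinds at the bound names; their decodings are the
      -- objects to which the hypothesis is applied.
      choose c hcO hcw hck using hwk
      refine (ih (d + 1) (Node.bind d e) _ hw
        (extend v' fun y => decode κ b (Δ y) (c y)) ?_ _ (hkid hξ rfl)).2 (hall _)
      rintro (x | y)
      · exact hvw _ (R.K _) (hne x) _ (hO _ _) (hvv x)
      · have := code_decode hM (R.om ▸ hck y)
        simp only [Node.bind, Sum.elim_inr, extend, this]
        exact hcw y

end Decode

/-- A coded structure yields a model of the coded theory. -/
theorem satisfiable_of_models {κ : Cardinal.{u}} [hκ : Fact (ℵ₀ < κ)] {L : Language.{u}}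
    (hL : L.ArityLT κ) {t : Table ZFSet.{u}} {M₀ O V S α : ZFSet.{u}} {N : Idx κ → Node L κ}
    (hN : ∀ ξ, (N ξ).Ok) (hN' : ∀ ξ, (N ξ).kids ⊆ Set.range N)
    {rt : Idx κ → Idx κ} (R : (Node.coding N rt).Reads t) (h : t.Models M₀ O V S α)
    (hα : ∀ i : Idx κ, i.set ∈ α) {φ : Idx κ → Sentence L}
    (hφ : ∀ i, N (rt i) = Node.form (φ i) 0 PEmpty.elim) : Satisfiable (Set.range φ) := by
  -- The elements of M₀ form a type one universe too high, so the model lives on its shrinking.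
  let b : Shrink.{u} M₀ → ZFSet.{u} := fun m => ((equivShrink M₀).symm m).1
  have hb : Function.Injective b := Subtype.val_injective.comp (equivShrink M₀).symm.injective
  have hM : ∀ x, x ∈ M₀ ↔ ∃ m, b m = x := fun x =>
    ⟨fun hx => ⟨equivShrink M₀ ⟨x, hx⟩, by simp [b]⟩, by rintro ⟨m, rfl⟩; exact Subtype.prop _⟩
  obtain ⟨m₀, hm₀, -⟩ := h.1.1
  have hne : Nonempty (Shrink.{u} M₀) := ⟨equivShrink M₀ ⟨m₀, hm₀⟩⟩
  have ho := h.1.2.1 _ hm₀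
  refine ⟨_, hne, decodeInterp b t O V S N m₀, ?_⟩
  rintro _ ⟨i, rfl⟩
  have hv : IsFunc t.K O (mkFun t.K fun _ => m₀) := isFunc_mkFun fun _ _ => ho
  exact (mem_sat_iff hb hM ho hL hN hN' R h (φ i) 0 PEmpty.elim _ hv (fun x => PEmpty.elim x)
    (fun x => x.elim) _ (hφ i)).1
    (h.2.1 _ (hα i) _ (R.K _) ((R.rt _ _).2 rfl) _ hv)

/-! ### Satisfiability from partial elementary embeddings -/

/-- The unbounded z is harmless: if (x, z) lies in h, transitivity of V_β puts z into the level.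
This property carries single values of a graph along j. -/
theorem UD.graph {X : Type} (x y h : X) :
    UD fun _ w => ∀ z, pair (w x) z ∈ w h ↔ z = w y := by
  refine UD.congr (P := fun β w => ∀ z ∈ vonNeumann β, pair (w x) z ∈ w h ↔ z = w y)
    (all ((pair_mem _ _ _).iff (eq _ _))) fun β _ w hw => ⟨fun H z => ?_, fun H z _ => H z⟩
  constructor
  · intro hz
    refine (H z ?_).1 hz
    have h1 := mem_level_of_mem hz (hw h)
    have h2 : ({w x, z} : ZFSet) ∈ pair (w x) z := by simp [pair]
    exact mem_level_of_mem (ZFSet.mem_pair.2 (.inr rfl)) (mem_level_of_mem h2 h1)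
  · rintro rfl
    exact (H _ (hw y)).2 rfl

theorem UD.graph₂ {X : Type} (x x' y h : X) :
    UD fun _ w => ∀ z, pair (w x) (pair (w x') z) ∈ w h ↔ z = w y := by
  refine UD.congr (P := fun β w => ∀ z ∈ vonNeumann β, pair (w x) (pair (w x') z) ∈ w h ↔ z = w y)
    (all ((pair_pair_mem _ _ _ _).iff (eq _ _))) fun β _ w hw =>
      ⟨fun H z => ?_, fun H z _ => H z⟩
  constructor
  · intro hz
    refine (H z ?_).1 hz
    have h1 := mem_level_of_mem hz (hw h)
    have h2 : ({w x, pair (w x') z} : ZFSet) ∈ pair (w x) (pair (w x') z) := by simp [pair]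
    have h3 := mem_level_of_mem (ZFSet.mem_pair.2 (.inr rfl)) (mem_level_of_mem h2 h1)
    have h4 : ({w x', z} : ZFSet) ∈ pair (w x') z := by simp [pair]
    exact mem_level_of_mem (ZFSet.mem_pair.2 (.inr rfl)) (mem_level_of_mem h4 h3)
  · rintro rfl
    exact (H _ (hw y)).2 rfl

theorem funs_subset {x y : ZFSet.{u}} : funs x y ⊆ powerset (prod x y) := fun _ hf =>
  ZFSet.mem_powerset.2 (ZFSet.mem_funs.1 hf).1

section

variable {κ : Cardinal.{u}} [hκ : Fact (ℵ₀ < κ)] {μ : Cardinal.{u}}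

theorem isSuccLimit_ord_of_lt (hμ : κ < μ) : IsSuccLimit μ.ord :=
  Cardinal.isSuccLimit_ord (hκ.out.trans hμ).le

omit hκ in
theorem toZFSet_ord_mem_level (hμ : κ < μ) : κ.ord.toZFSet ∈ vonNeumann μ.ord := by
  rw [mem_vonNeumann, Ordinal.rank_toZFSet]
  exact Cardinal.ord_lt_ord.2 hμ

/-- A model of size < μ is moved to an ordinal below μ. All codes are then found a few power sets
and products above κ and that ordinal, hence in V_μ as μ is a limit. -/
theorem exists_models_mem_level (hμ : κ < μ) {L : Language.{u}} (hL : L.ArityLT κ)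
    {N : Idx κ → Node L κ} (hN : ∀ ξ, (N ξ).Ok) (hN' : ∀ ξ, (N ξ).kids ⊆ Set.range N)
    {rt : Idx κ → Idx κ} {φ : Idx κ → Sentence L}
    (hφ : ∀ i, N (rt i) = Node.form (φ i) 0 PEmpty.elim) (α : Idx κ) {M : Type u} [Nonempty M]
    {A : Interp L M} (hM : #M < μ) (hA : ∀ i < α, Sentence.True A (φ i)) :
    ∃ M₀ ∈ vonNeumann μ.ord, ∃ O ∈ vonNeumann μ.ord, ∃ V ∈ vonNeumann μ.ord,
      ∃ S ∈ vonNeumann μ.ord, (Node.coding N rt).table.Models M₀ O V S α.set := by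
  have hlim := isSuccLimit_ord_of_lt hμ
  have hK := toZFSet_ord_mem_level hμ
  let e : M ≃ Idx #M := Classical.choice (Cardinal.eq.1 (by simp))
  let b : M → ZFSet.{u} := fun m => (e m).set
  have hb : Function.Injective b := Idx.set_injective.comp e.injective
  have hbM : ∀ x, x ∈ (#M).ord.toZFSet ↔ ∃ m, b m = x := fun x => by
    rw [mem_toZFSet_ord]
    exact e.surjective.exists
  have hM₀ : (#M).ord.toZFSet ∈ vonNeumann μ.ord := by
    rw [mem_vonNeumann, Ordinal.rank_toZFSet]
    exact Cardinal.ord_lt_ord.2 hM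
  have hom : (Idx.omega (κ := κ)).set ∈ vonNeumann μ.ord :=
    mem_level_of_mem (mem_toZFSet_ord.2 ⟨_, rfl⟩) hK
  -- Tuples are functions on natural numbers, thus subsets of ω × M, so a second power set contains
  -- the relations of all finite arities at once.
  let O := (#M).ord.toZFSet ∪
    powerset (powerset (prod (Idx.omega (κ := κ)).set (#M).ord.toZFSet))
  have hOmem : O ∈ vonNeumann μ.ord := union_mem_level hM₀
    (powerset_mem_level hlim (powerset_mem_level hlim (prod_mem_level hlim hom hM₀)))
  have hO : ∀ (k : Kind.{u}) o, code κ b k o ∈ O := by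
    intro k o
    cases k with
    | ind => exact ZFSet.mem_union.2 (.inl ((hbM _).2 ⟨o, rfl⟩))
    | set n =>
      refine ZFSet.mem_union.2 (.inr (ZFSet.mem_powerset.2 fun u hu => ZFSet.mem_powerset.2 ?_))
      obtain ⟨s, -, rfl⟩ := mem_code_set.1 hu
      intro z hz
      obtain ⟨i, rfl⟩ := mem_range.1 hz
      exact pair_mem_prod.2 ⟨Idx.mem_set_omega.2 ⟨i, rfl⟩, (hbM _).2 ⟨_, rfl⟩⟩
  have hfuns : funs κ.ord.toZFSet O ∈ vonNeumann μ.ord := mem_vonNeumann_of_subset funs_subset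
    (powerset_mem_level hlim (prod_mem_level hlim hK hOmem))
  refine ⟨_, hM₀, O, hOmem, valSet A b N O, ?_, satSet A b N O, ?_,
    models_of_holds hb hbM hO hL hN hN' fun i hi v => ?_⟩
  · exact mem_vonNeumann_of_subset (fun z hz => (ZFSet.mem_sep.1 hz).1)
      (prod_mem_level hlim hK (prod_mem_level hlim hfuns hOmem))
  · exact mem_vonNeumann_of_subset (fun z hz => (ZFSet.mem_sep.1 hz).1)
      (prod_mem_level hlim hK hfuns)
  · rw [hφ]
    have := hA i hi
    rw [Sentence.True] at this
    rw [Node.Sat]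
    convert this using 1
    funext x
    exact x.elim

/-- Names for the components of a table. -/
def tableNames : Table (Fin 7 ⊕ Fin 9) :=
  ⟨.inl 0, .inl 1, .inl 2, .inl 3, .inl 4, .inl 5, .inl 6, .inr⟩

/-- The components of a table as a family. -/
def Table.get {α : Type*} (t : Table α) : Fin 7 ⊕ Fin 9 → α :=
  Sum.elim ![t.K, t.om, t.hd, t.ln, t.ar, t.kn, t.rt] t.tg

theorem Coding.table_get_mem_level (hμ : κ < μ) (C : Coding κ) (n : Fin 7 ⊕ Fin 9) :
    C.table.get n ∈ vonNeumann μ.ord := by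
  have hlim := isSuccLimit_ord_of_lt hμ
  have hK := toZFSet_ord_mem_level hμ
  have hg : ∀ h : Idx κ → Idx κ, SecondOrder.graph h ∈ vonNeumann μ.ord := fun h =>
    mem_vonNeumann_of_subset (graph_subset h) (prod_mem_level hlim hK hK)
  have hg₂ : ∀ h : Idx κ → Idx κ → Idx κ, SecondOrder.graph₂ h ∈ vonNeumann μ.ord := fun h =>
    mem_vonNeumann_of_subset (graph₂_subset h)
      (prod_mem_level hlim hK (prod_mem_level hlim hK hK))
  rcases n with n | n
  · fin_cases n
    exacts [hK, mem_level_of_mem (mem_toZFSet_ord.2 ⟨_, rfl⟩) hK, hg _, hg _, hg₂ _, hg₂ _, hg _]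
  · have : C.table.tg n ⊆ κ.ord.toZFSet := by
      simp only [Coding.table]
      exact ZFSet.sep_subset
    exact mem_vonNeumann_of_subset this hK

/-- The "first α sentences have a coded model" statement, true in V_μ for all α ∈ κ, is applied in
V_β at a new ordinal α ∈ j(κ), which lies above all indices. -/
theorem satisfiable_of_embeddingPropertyAt (hμ : κ < μ) (hE : EmbeddingPropertyAt κ μ.ord)
    {L : Language.{u}} (hL : L.ArityLT κ) {φ : Idx κ → Sentence L} (hφ : ∀ i, (φ i).InL2 κ κ)
    (hsat : ∀ α : Idx κ, ∃ (M : Type u) (_ : Nonempty M) (A : Interp L M), #M < μ ∧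
      ∀ i < α, Sentence.True A (φ i)) : Satisfiable (Set.range φ) := by
  have hlim := isSuccLimit_ord_of_lt hμ
  have hK := toZFSet_ord_mem_level hμ
  obtain ⟨N, hN, hroot, hN'⟩ := Node.exists_numbering hL (fun i => Node.form (φ i) 0 PEmpty.elim)
    fun i => ⟨hφ i, fun x => x.elim⟩
  let rt : Idx κ → Idx κ := fun i => numOf N (Node.form (φ i) 0 PEmpty.elim)
  have hrt : ∀ i, N (rt i) = Node.form (φ i) 0 PEmpty.elim := fun i => numOf_spec (hroot i)
  let C := Node.coding N rt
  -- The domain D: the ordinals up to and including κ, and the sixteen components of the table.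
  let g : Option (Idx κ) ⊕ (Fin 7 ⊕ Fin 9) → VLevel μ.ord := Sum.elim
    (fun o => o.elim ⟨_, hK⟩ fun i => ⟨i.set, mem_level_of_mem (mem_toZFSet_ord.2 ⟨i, rfl⟩) hK⟩)
    fun n => ⟨_, C.table_get_mem_level hμ n⟩
  have hD : #(Set.range g) = lift.{u + 1} κ := by
    apply le_antisymm
    · have h1 := Cardinal.mk_range_le_lift (f := g)
      rw [Cardinal.lift_id'.{u, u + 1}] at h1
      refine h1.trans (Cardinal.lift_le.2 ?_)
      rw [Cardinal.mk_sum, Cardinal.mk_option, Cardinal.mk_ord_toType, Cardinal.lift_uzero,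
        Cardinal.add_one_eq hκ.out.le]
      refine Cardinal.add_le_of_le hκ.out.le le_rfl ?_
      refine le_trans ?_ hκ.out.le
      simp
    · have h1 := Cardinal.lift_mk_le_lift_mk_of_injective
        (f := fun i : Idx κ => (⟨g (.inl (some i)), _, rfl⟩ : Set.range g)) fun i j h =>
          Idx.set_injective (congrArg (fun x : Set.range g => x.1.1) h)
      rwa [Cardinal.mk_ord_toType, Cardinal.lift_id'.{u, u + 1}] at h1
  obtain ⟨β, j, hj, hcrit⟩ := hE (Set.range g) (fun δ hδ => by
    rcases hδ.lt_or_eq with h | rfl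
    · exact ⟨g (.inl (some (Ordinal.ToType.mk ⟨δ, h⟩))), ⟨_, rfl⟩, Idx.set_mk h⟩
    · exact ⟨g (.inl none), ⟨_, rfl⟩, rfl⟩) hD
  have hβ := hj.isSuccLimit hlim ⟨⟨_, .inl none, rfl⟩⟩
  let dI : Idx κ → Set.range g := fun i => ⟨g (.inl (some i)), _, rfl⟩
  let dT : Fin 7 ⊕ Fin 9 → Set.range g := fun n => ⟨g (.inr n), _, rfl⟩
  have hjI : ∀ i, (j (dI i) : ZFSet.{u}) = i.set := by
    intro i
    by_contra hne
    exact absurd (hcrit.2 ⟨dI i, rfl, hne⟩) (not_le.2 i.toOrd.2)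
  have hjK : (j (dT (.inl 0)) : ZFSet.{u}) ≠ κ.ord.toZFSet := by
    obtain ⟨⟨x, hx⟩, hx1, hx2⟩ := hcrit.1
    have : (⟨x, hx⟩ : Set.range g) = dT (.inl 0) := Subtype.ext (Subtype.ext hx1)
    rwa [this] at hx2
  let t : Table ZFSet.{u} := tableNames.map fun n => (j (dT n) : ZFSet.{u})
  have hRead := C.reads_table
  have R : C.Reads t := by
    have h1 : ∀ (n : Fin 7 ⊕ Fin 9) (h : Idx κ → Idx κ),
        (∀ ξ z, pair ξ.set z ∈ C.table.get n ↔ z = (h ξ).set) →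
        ∀ ξ z, pair ξ.set z ∈ (j (dT n) : ZFSet.{u}) ↔ z = (h ξ).set := by
      intro n h H ξ
      have := (hj.transfer hlim hβ (UD.graph (X := Fin 3) 0 1 2) ![dI ξ, dI (h ξ), dT n]).1 (H ξ)
      simpa [hjI] using this
    have h2 : ∀ (n : Fin 7 ⊕ Fin 9) (h : Idx κ → Idx κ → Idx κ),
        (∀ ξ i z, pair ξ.set (pair i.set z) ∈ C.table.get n ↔ z = (h ξ i).set) →
        ∀ ξ i z, pair ξ.set (pair i.set z) ∈ (j (dT n) : ZFSet.{u}) ↔ z = (h ξ i).set := by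
      intro n h H ξ i
      have := (hj.transfer hlim hβ (UD.graph₂ (X := Fin 4) 0 1 2 3)
        ![dI ξ, dI i, dI (h ξ i), dT n]).1 (H ξ i)
      simpa [hjI] using this
    have h3 : ∀ (i : Idx κ) n, i.set ∈ C.table.get n ↔ i.set ∈ (j (dT n) : ZFSet.{u}) := by
      intro i n
      have := hj.transfer hlim hβ (UD.mem (X := Fin 2) 0 1) ![dI i, dT n]
      simp only [Matrix.cons_val_zero, Matrix.cons_val_one, hjI] at this
      exact this
    exact
      { K := fun i => (h3 i (.inl 0)).1 (hRead.K i)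
        om := by
          have := (hj.transfer hlim hβ (UD.eq (X := Fin 2) 0 1) ![dT (.inl 1), dI Idx.omega]).1 rfl
          exact this.trans (hjI _)
        tg := fun ξ n => (h3 ξ (.inr n)).symm.trans (hRead.tg ξ n)
        hd := h1 (.inl 2) _ hRead.hd
        ln := h1 (.inl 3) _ hRead.ln
        rt := h1 (.inl 6) _ hRead.rt
        ar := h2 (.inl 4) _ hRead.ar
        kn := h2 (.inl 5) _ hRead.kn }
  -- j(κ) contains every index and differs from κ, hence has a further element.
  obtain ⟨α, hαK, hα⟩ : ∃ α ∈ t.K, ∀ i : Idx κ, i.set ≠ α := by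
    by_contra! hcon
    refine hjK (ZFSet.ext fun z => ⟨fun hz => mem_toZFSet_ord.2 (hcon z hz), fun hz => ?_⟩)
    obtain ⟨i, rfl⟩ := mem_toZFSet_ord.1 hz
    exact R.K i
  have hα' : ∀ i : Idx κ, i.set ∈ α := by
    intro i
    -- Comparability with i, transferred from κ to j(κ), leaves only i ∈ α, since anything equal to
    -- i or in i is an index.
    have hUD : UD.{u} fun _ (w : Fin 2 → ZFSet.{u}) =>
        ∀ a ∈ w 1, w 0 ∈ a ∨ a = w 0 ∨ a ∈ w 0 :=
      .ball _ ((UD.mem _ _).or ((UD.eq _ _).or (UD.mem _ _)))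
    have h1 : ∀ a ∈ κ.ord.toZFSet, i.set ∈ a ∨ a = i.set ∨ a ∈ i.set := by
      intro a ha
      obtain ⟨i', rfl⟩ := mem_toZFSet_ord.1 ha
      rw [Idx.set_mem_set, Idx.set_mem_set, Idx.set_inj]
      exact (lt_trichotomy i i').imp_right (Or.imp_left Eq.symm)
    have h2 := (hj.transfer hlim hβ hUD ![dI i, dT (.inl 0)]).1 h1 α hαK
    simp only [Matrix.cons_val_zero, hjI] at h2
    rcases h2 with h2 | h2 | h2
    · exact h2
    · exact absurd h2.symm (hα i)
    · obtain ⟨i', -, h3⟩ := Idx.mem_set.1 h2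
      exact absurd h3 (hα i')
  have hmain := (hj.transfer hlim hβ (UD.forall_exists_models tableNames) dT).1 (by
    intro x hx
    obtain ⟨i, rfl⟩ := mem_toZFSet_ord.1 hx
    obtain ⟨M, hMne, A, hM, hA⟩ := hsat i
    exact exists_models_mem_level hμ hL hN hN' hrt i hM hA)
  obtain ⟨M₀, -, O, -, V, -, S, -, hmod⟩ := hmain α hαK
  exact satisfiable_of_models hL hN hN' R hmod hα' hrt

end

/-! ### A language for levels of the cumulative hierarchy -/

/-- The language with a binary relation and a constant for each element of `C`. -/
abbrev constLang (C : Type u) : Language.{u} where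
  Fn := C
  FnArity _ := PEmpty
  fnIn _ i := i.elim
  fnOut _ := .ind
  Rl := PUnit
  RlArity _ := ULift (Fin 2)
  rlIn _ _ := .ind

section Formulas

variable {C : Type u} {M : Type u} (A : Interp (constLang C) M)

/-- The relation of a structure. -/
def Interp.E (a b : M) : Prop := A.rl PUnit.unit fun i => ![a, b] i.down

/-- The constants of a structure. -/
def Interp.c (o : C) : M := A.fn o fun i => i.elim

/-- The structure given by a relation and constants. -/
def mkInterp (E : M → M → Prop) (c : C → M) : Interp (constLang C) M where
  fn o _ := c o
  rl _ a := E (a ⟨0⟩) (a ⟨1⟩)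

variable {X : Type u} {Γ : X → Kind.{u}} {k : Kind.{u}}

/-- A constant as a term. -/
def cst (o : C) : Term (constLang C) Γ Kind.ind := Term.app (L := constLang C) o fun i => i.elim

/-- The last variable. -/
def lastVar {L : Language.{u}} : Term L (Sum.elim Γ fun _ : PUnit.{u + 1} => k) k :=
  Term.var (Γ := Sum.elim Γ fun _ : PUnit.{u + 1} => k) (Sum.inr PUnit.unit)

/-- A term as a term with additional variables. -/
def Term.lift {L : Language.{u}} {Y : Type u} {Δ : Y → Kind.{u}} :
    {k : Kind.{u}} → Term L Γ k → Term L (Sum.elim Γ Δ) k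
  | _, .var x => .var (Γ := Sum.elim Γ Δ) (.inl x)
  | _, .app f ts => .app f fun i => (ts i).lift

/-- The atomic formula `s E t`. -/
def elemF (s t : Term (constLang C) Γ Kind.ind) : Formula (constLang C) Γ :=
  .rel (L := constLang C) PUnit.unit fun i => ![s, t] i.down

section

variable {L : Language.{u}}

/-- Implication. -/
def impF (φ ψ : Formula L Γ) : Formula L Γ :=
  .neg (.conj fun i : ULift.{u} Bool => if i.down then φ else .neg ψ)

/-- Quantification over one variable. -/
def allF (k : Kind.{u}) (φ : Formula L (Sum.elim Γ fun _ : PUnit.{u + 1} => k)) : Formula L Γ :=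
  .all _ φ

/-- Existential quantification over one variable. -/
def exF (k : Kind.{u}) (φ : Formula L (Sum.elim Γ fun _ : PUnit.{u + 1} => k)) : Formula L Γ :=
  .neg (allF k (.neg φ))

/-- Conjunction. -/
def andF (φ ψ : Formula L Γ) : Formula L Γ := .neg (impF φ (.neg ψ))

theorem lift_val {A : Interp L M} {Y : Type u} {Δ : Y → Kind.{u}} {v : (x : X) → (Γ x).Obj M}
    {w : (y : Y) → (Δ y).Obj M} (t : Term L Γ k) :
    (t.lift : Term L (Sum.elim Γ Δ) k).val A (extend v w) = t.val A v := by
  induction t with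
  | var x => rfl
  | app f ts ih => exact congrArg (A.fn f) (funext ih)

theorem lastVar_val {A : Interp L M} {v : (x : X) → (Γ x).Obj M} {a : k.Obj M} :
    (lastVar : Term L (Sum.elim Γ fun _ : PUnit.{u + 1} => k) k).val A
      (extend v fun _ => a) = a := rfl

theorem impF_holds {A : Interp L M} {v : (x : X) → (Γ x).Obj M} {φ ψ : Formula L Γ} :
    (impF φ ψ).Holds A v ↔ (φ.Holds A v → ψ.Holds A v) := by
  simp only [impF, Formula.Holds, ULift.forall, Bool.forall_bool]
  simp only [Bool.false_eq_true, if_false, if_true, Formula.Holds]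
  tauto

theorem allF_holds {A : Interp L M} {v : (x : X) → (Γ x).Obj M}
    {φ : Formula L (Sum.elim Γ fun _ : PUnit.{u + 1} => k)} :
    (allF k φ).Holds A v ↔ ∀ a : k.Obj M, φ.Holds A (extend v fun _ => a) :=
  ⟨fun h a => h fun _ => a, fun h w => h (w PUnit.unit)⟩

theorem negF_holds {A : Interp L M} {v : (x : X) → (Γ x).Obj M} {φ : Formula L Γ} :
    (Formula.neg φ).Holds A v ↔ ¬ φ.Holds A v := Iff.rfl

theorem exF_holds {A : Interp L M} {v : (x : X) → (Γ x).Obj M}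
    {φ : Formula L (Sum.elim Γ fun _ : PUnit.{u + 1} => k)} :
    (exF k φ).Holds A v ↔ ∃ a : k.Obj M, φ.Holds A (extend v fun _ => a) := by
  rw [exF, negF_holds, allF_holds]
  simp only [negF_holds, not_forall, not_not]

theorem andF_holds {A : Interp L M} {v : (x : X) → (Γ x).Obj M} {φ ψ : Formula L Γ} :
    (andF φ ψ).Holds A v ↔ φ.Holds A v ∧ ψ.Holds A v := by
  rw [andF, negF_holds, impF_holds, negF_holds]
  tauto

theorem eqF_holds {A : Interp L M} {v : (x : X) → (Γ x).Obj M} {s t : Term L Γ k} :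
    (Formula.eq s t).Holds A v ↔ s.val A v = t.val A v := Iff.rfl

/-- Membership of a tuple of individuals. -/
def memF {n : ℕ} (ts : Fin n → Term L Γ Kind.ind) (S : Term L Γ (Kind.set n)) : Formula L Γ :=
  .mem ts S

/-- Membership of a tuple in a second-order object. -/
def SetMem {n : ℕ} (p : Fin n → M) (B : Kind.Obj M (.set n)) : Prop :=
  let R : Set (Fin n → M) := B
  p ∈ R

theorem memF_one_holds {A : Interp L M} {v : (x : X) → (Γ x).Obj M} {s : Term L Γ Kind.ind}
    {S : Term L Γ (Kind.set 1)} :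
    (memF ![s] S).Holds A v ↔ SetMem (M := M) ![s.val A v] (S.val A v) := by
  refine iff_of_eq (congrArg (fun p => SetMem p (S.val A v)) (funext fun i => ?_))
  fin_cases i
  rfl

theorem memF_two_holds {A : Interp L M} {v : (x : X) → (Γ x).Obj M} {s t : Term L Γ Kind.ind}
    {S : Term L Γ (Kind.set 2)} :
    (memF ![s, t] S).Holds A v ↔ SetMem (M := M) ![s.val A v, t.val A v] (S.val A v) := by
  refine iff_of_eq (congrArg (fun p => SetMem p (S.val A v)) (funext fun i => ?_))
  fin_cases i <;> rfl

theorem impF_inL2 {lam κ : Cardinal.{u}} (hlam : ℵ₀ ≤ lam) {φ ψ : Formula L Γ} :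
    (impF φ ψ).InL2 lam κ ↔ φ.InL2 lam κ ∧ ψ.InL2 lam κ := by
  have : #(ULift.{u} Bool) < lam := (Cardinal.lt_aleph0_of_finite _).trans_le hlam
  simp only [impF, Formula.InL2, this, ULift.forall, Bool.forall_bool, true_and]
  simp only [Bool.false_eq_true, if_false, if_true, Formula.InL2]
  tauto

theorem allF_inL2 {lam κ : Cardinal.{u}} (hκ : ℵ₀ ≤ κ)
    {φ : Formula L (Sum.elim Γ fun _ : PUnit.{u + 1} => k)} :
    (allF k φ).InL2 lam κ ↔ φ.InL2 lam κ :=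
  and_iff_right ((Cardinal.lt_aleph0_of_finite _).trans_le hκ)

end

theorem elemF_holds {v : (x : X) → (Γ x).Obj M} {s t : Term (constLang C) Γ Kind.ind} :
    (elemF s t).Holds A v ↔ A.E (s.val A v) (t.val A v) := by
  refine iff_of_eq (congrArg (A.rl PUnit.unit) (funext fun i => ?_))
  rcases i with ⟨i⟩
  fin_cases i <;> rfl

theorem cst_val {v : (x : X) → (Γ x).Obj M} (o : C) : (cst o : Term _ Γ _).val A v = A.c o :=
  congrArg (A.fn o) (funext fun i => i.elim)

variable (C) in
/-- Extensionality. -/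
def extSentence : Sentence (constLang C) :=
  allF .ind <| allF .ind <| impF
    (allF .ind <| andF (impF (elemF lastVar lastVar.lift.lift) (elemF lastVar lastVar.lift))
      (impF (elemF lastVar lastVar.lift) (elemF lastVar lastVar.lift.lift)))
    (.eq lastVar.lift lastVar)

variable (C) in
/-- Well-foundedness. -/
def wfSentence : Sentence (constLang C) :=
  allF (.set 1) <| allF .ind <| impF (memF ![lastVar] lastVar.lift) <|
    exF .ind <| andF (memF ![lastVar] lastVar.lift.lift) <|
      allF .ind <| impF (memF ![lastVar] lastVar.lift.lift.lift) (.neg (elemF lastVar lastVar.lift))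

variable (C) in
/-- Every set of elements whose rank, as compared by means of a simulation, is at most the rank of an
element is the extension of an element. -/
def fullSentence : Sentence (constLang C) :=
  allF (.set 2) <| allF (.set 1) <| allF .ind <|
    impF
      (allF .ind <| allF .ind <| impF (memF ![lastVar.lift, lastVar] lastVar.lift.lift.lift.lift) <|
        allF .ind <| impF (elemF lastVar lastVar.lift.lift) <| exF .ind <|
          andF (elemF lastVar lastVar.lift.lift)
            (memF ![lastVar.lift, lastVar] lastVar.lift.lift.lift.lift.lift.lift)) <|
    impF
      (allF .ind <| impF (memF ![lastVar] lastVar.lift.lift) <| exF .ind <|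
        andF (elemF lastVar lastVar.lift.lift)
          (memF ![lastVar.lift, lastVar] lastVar.lift.lift.lift.lift)) <|
    exF .ind <| allF .ind <|
      andF (impF (elemF lastVar lastVar.lift) (memF ![lastVar] lastVar.lift.lift.lift))
        (impF (memF ![lastVar] lastVar.lift.lift.lift) (elemF lastVar lastVar.lift))

theorem extSentence_inL2 : (extSentence C).InL2 ℵ₀ ℵ₀ := by
  simp [extSentence, allF_inL2, impF_inL2, andF, elemF, Formula.InL2]

theorem wfSentence_inL2 : (wfSentence C).InL2 ℵ₀ ℵ₀ := by
  simp [wfSentence, allF_inL2, impF_inL2, andF, elemF, exF, memF, Formula.InL2]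

theorem fullSentence_inL2 : (fullSentence C).InL2 ℵ₀ ℵ₀ := by
  simp [fullSentence, allF_inL2, impF_inL2, andF, elemF, exF, memF, Formula.InL2]

theorem extSentence_true : Sentence.True A (extSentence C) ↔
    ∀ x y, (∀ z, (A.E z x → A.E z y) ∧ (A.E z y → A.E z x)) → x = y := by
  simp only [Sentence.True, extSentence, allF_holds, impF_holds, andF_holds, elemF_holds,
    eqF_holds, lift_val, lastVar_val]
  rfl

theorem wfSentence_true : Sentence.True A (wfSentence C) ↔
    ∀ (S : Set (Fin 1 → M)) (x : M), ![x] ∈ S →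
      ∃ m : M, ![m] ∈ S ∧ ∀ y : M, ![y] ∈ S → ¬ A.E y m := by
  simp only [Sentence.True, wfSentence, allF_holds, impF_holds, andF_holds, elemF_holds, exF_holds,
    negF_holds, memF_one_holds, lift_val, lastVar_val]
  rfl

theorem fullSentence_true : Sentence.True A (fullSentence C) ↔
    ∀ (R : Set (Fin 2 → M)) (S : Set (Fin 1 → M)) (x : M),
      (∀ y z : M, ![y, z] ∈ R → ∀ y', A.E y' y → ∃ z', A.E z' z ∧ ![y', z'] ∈ R) →
      (∀ y : M, ![y] ∈ S → ∃ z, A.E z x ∧ ![y, z] ∈ R) →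
      ∃ s : M, ∀ t : M, (A.E t s → ![t] ∈ S) ∧ (![t] ∈ S → A.E t s) := by
  simp only [Sentence.True, fullSentence, allF_holds, impF_holds, andF_holds, elemF_holds,
    exF_holds, memF_one_holds, memF_two_holds, lift_val, lastVar_val]
  rfl

/-- A structure as a structure for the language of set theory. -/
@[reducible]
def Interp.toStructure : setLang.Structure M where
  funMap := fun f => Empty.elim f
  RelMap := fun r => match r with
    | MemSymb.mem => fun x => A.E (x 0) (x 1)

/-- First-order formulas of the language of set theory, with terms substituted for the variables, are
formulas of second-order logic. -/
theorem exists_translation {α : Type u} {n : ℕ} (φ : setLang.BoundedFormula α n) :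
    ∀ {X : Type u} {Γ : X → Kind.{u}} (σ : α ⊕ Fin n → Term (constLang C) Γ Kind.ind),
      ∃ ψ : Formula (constLang C) Γ, ψ.InL2 ℵ₀ ℵ₀ ∧
        ∀ {M : Type u} (A : Interp (constLang C) M) (v : (x : X) → (Γ x).Obj M),
          ψ.Holds A v ↔ @FirstOrder.Language.BoundedFormula.Realize setLang M A.toStructure α n φ
            (fun a => (σ (.inl a)).val A v) fun i => (σ (.inr i)).val A v := by
  have tv : ∀ {m : ℕ} (t : setLang.Term (α ⊕ Fin m)), ∃ x, t = FirstOrder.Language.Term.var x := by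
    intro m t
    cases t with
    | var x => exact ⟨x, rfl⟩
    | func f _ => exact Empty.elim f
  have hval : ∀ {X : Type u} {Γ : X → Kind.{u}} {m : ℕ}
      (σ : α ⊕ Fin m → Term (constLang C) Γ Kind.ind)
      {M : Type u} (A : Interp (constLang C) M) (v : (x : X) → (Γ x).Obj M) (x : α ⊕ Fin m),
      (Sum.elim (fun a => (σ (.inl a)).val A v) (fun i => (σ (.inr i)).val A v) x : M) =
        (σ x).val A v := by
    rintro X Γ m σ M A v (x | x) <;> rfl
  induction φ with
  | falsum =>
    intro X Γ σ
    refine ⟨.neg (.conj fun i : PEmpty => i.elim), ⟨Cardinal.lt_aleph0_of_finite _,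
      fun i => i.elim⟩, fun A v => ?_⟩
    exact iff_of_false (fun h => h fun i => i.elim) id
  | equal t s =>
    intro X Γ σ
    obtain ⟨x, rfl⟩ := tv t
    obtain ⟨y, rfl⟩ := tv s
    refine ⟨.eq (σ x) (σ y), trivial, fun A v => ?_⟩
    rw [eqF_holds, ← hval σ A v x, ← hval σ A v y]
    rfl
  | rel r ts =>
    intro X Γ σ
    cases r with
    | mem =>
      obtain ⟨x, hx⟩ := tv (ts 0)
      obtain ⟨y, hy⟩ := tv (ts 1)
      refine ⟨elemF (σ x) (σ y), trivial, fun A v => ?_⟩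
      have key : ∀ (t : setLang.Term (α ⊕ Fin _)) (z : α ⊕ Fin _),
          t = FirstOrder.Language.Term.var z →
          (σ z).val A v = @FirstOrder.Language.Term.realize setLang _ A.toStructure _
            (Sum.elim (fun a => (σ (.inl a)).val A v) fun i => (σ (.inr i)).val A v) t := by
        rintro _ z rfl
        exact (hval σ A v z).symm
      rw [elemF_holds]
      exact iff_of_eq (congrArg₂ A.E (key _ _ hx) (key _ _ hy))
  | imp φ ψ ih₁ ih₂ =>
    intro X Γ σ
    obtain ⟨φ', h₁, h₁'⟩ := ih₁ σ
    obtain ⟨ψ', h₂, h₂'⟩ := ih₂ σ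
    refine ⟨impF φ' ψ', (impF_inL2 le_rfl).2 ⟨h₁, h₂⟩, fun A v => ?_⟩
    rw [impF_holds, h₁', h₂']
    rfl
  | @all m φ ih =>
    intro X Γ σ
    -- Under the quantifier the old terms are weakened, and the new de Bruijn variable becomes the
    -- newly bound one.
    obtain ⟨φ', h, h'⟩ := ih (Γ := Sum.elim Γ fun _ : PUnit.{u + 1} => Kind.ind)
      (Sum.elim (fun a => (σ (.inl a)).lift)
        (Fin.snoc (α := fun _ => Term (constLang C) _ Kind.ind) (fun i => (σ (.inr i)).lift)
          lastVar))
    refine ⟨allF .ind φ', (allF_inL2 le_rfl).2 h, fun {M} A v => ?_⟩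
    rw [allF_holds]
    refine forall_congr' fun a => ?_
    rw [h']
    simp only [Sum.elim_inl, Sum.elim_inr, lift_val]
    refine iff_of_eq (congrArg _ (funext fun i => ?_))
    refine Fin.lastCases ?_ (fun i => ?_) i
    · refine Eq.trans ?_ (Fin.snoc_last (α := fun _ => M) a _).symm
      rw [Fin.snoc_last]
      rfl
    · refine Eq.trans ?_ (Fin.snoc_castSucc (α := fun _ => M) a _ i).symm
      rw [Fin.snoc_castSucc, lift_val]

end Formulas

/-! ### Characterization of the levels of the hierarchy -/

section Collapse

variable {M : Type u} {E : M → M → Prop}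

/-- The Mostowski collapse of a well-founded relation. -/
noncomputable def collapse (hwf : WellFounded E) : M → ZFSet.{u} :=
  hwf.fix fun x ih => ZFSet.range fun y : {y // E y x} => ih y.1 y.2

theorem mem_collapse (hwf : WellFounded E) (x : M) (z : ZFSet.{u}) :
    z ∈ collapse hwf x ↔ ∃ y, E y x ∧ collapse hwf y = z := by
  rw [collapse, hwf.fix_eq, ZFSet.mem_range]
  simp

theorem collapse_injective (hwf : WellFounded E)
    (hext : ∀ x y, (∀ z, E z x ↔ E z y) → x = y) : Function.Injective (collapse hwf) := by
  intro x
  induction x using hwf.induction with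
  | _ x ih =>
    intro y hxy
    refine hext x y fun z => ⟨fun h => ?_, fun h => ?_⟩
    · have : collapse hwf z ∈ collapse hwf y := hxy ▸ (mem_collapse hwf x _).2 ⟨z, h, rfl⟩
      obtain ⟨z', h', he⟩ := (mem_collapse hwf y _).1 this
      exact ih z h he.symm ▸ h'
    · have : collapse hwf z ∈ collapse hwf x := hxy ▸ (mem_collapse hwf y _).2 ⟨z, h, rfl⟩
      obtain ⟨z', h', he⟩ := (mem_collapse hwf x _).1 this
      exact ih z' h' he ▸ h'

/-- Comparison of ranks of collapsed elements is a simulation, so fullness realizes every set of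
elements of rank below that of some x. The range of the Mostowski collapse is then a whole level. -/
theorem exists_level (hwf : WellFounded E) (hext : ∀ x y, (∀ z, E z x ↔ E z y) → x = y)
    (hfull : ∀ (R : M → M → Prop) (S : M → Prop) (x : M),
      (∀ y z, R y z → ∀ y', E y' y → ∃ z', E z' z ∧ R y' z') →
      (∀ y, S y → ∃ z, E z x ∧ R y z) → ∃ s, ∀ t, E t s ↔ S t) :
    ∃ (β : Ordinal.{u}) (π : M ≃ VLevel β), ∀ a b, E a b ↔ (π a).1 ∈ (π b).1 := by
  have hinj := collapse_injective hwf hext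
  have hE : ∀ a b, E a b ↔ collapse hwf a ∈ collapse hwf b := fun a b =>
    ⟨fun h => (mem_collapse hwf b _).2 ⟨a, h, rfl⟩, fun h => by
      obtain ⟨c, hc, he⟩ := (mem_collapse hwf b _).1 h
      exact hinj he ▸ hc⟩
  have hle : ∀ x : M, collapse hwf x ∈
      vonNeumann (ZFSet.range (collapse hwf)).rank := fun x =>
    mem_vonNeumann.2 (rank_lt_of_mem (ZFSet.mem_range.2 ⟨x, rfl⟩))
  have hsurj : ∀ z : ZFSet.{u}, z ∈ vonNeumann (ZFSet.range (collapse hwf)).rank →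
      ∃ x, collapse hwf x = z := by
    intro z
    induction z using ZFSet.inductionOn with
    | _ z ih =>
      intro hz
      have hsub : ∀ t ∈ z, ∃ y, collapse hwf y = t := fun t ht =>
        ih t ht (mem_level_of_mem ht hz)
      -- The level's height is the rank of the range of the collapse, so some collapsed x has rank
      -- at least that of z and can serve as the bound.
      obtain ⟨r, hr, hzr⟩ := lt_rank_iff.1 (mem_vonNeumann.1 hz)
      obtain ⟨x, rfl⟩ := ZFSet.mem_range.1 hr
      obtain ⟨s, hs⟩ := hfull (fun y w => (collapse hwf y).rank ≤ (collapse hwf w).rank)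
        (fun t => collapse hwf t ∈ z) x (by
          intro y w hyw y' hy'
          have := (rank_lt_of_mem ((hE _ _).1 hy')).trans_le hyw
          obtain ⟨r, hr, h⟩ := lt_rank_iff.1 this
          obtain ⟨w', hw', rfl⟩ := (mem_collapse hwf w _).1 hr
          exact ⟨w', hw', h⟩) (by
          intro y hy
          obtain ⟨r, hr, h⟩ := lt_rank_iff.1 ((rank_lt_of_mem hy).trans_le hzr)
          obtain ⟨w', hw', rfl⟩ := (mem_collapse hwf x _).1 hr
          exact ⟨w', hw', h⟩)
      refine ⟨s, ZFSet.ext fun t => ?_⟩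
      rw [mem_collapse]
      constructor
      · rintro ⟨y, hy, rfl⟩
        exact (hs y).1 hy
      · intro ht
        obtain ⟨y, rfl⟩ := hsub t ht
        exact ⟨y, (hs y).2 ht, rfl⟩
  refine ⟨_, Equiv.ofBijective (fun x => ⟨collapse hwf x, hle x⟩)
    ⟨fun a b h => hinj (congrArg Subtype.val h), fun z => ?_⟩, hE⟩
  obtain ⟨x, hx⟩ := hsurj z.1 z.2
  exact ⟨x, Subtype.ext hx⟩

end Collapse

section

variable {C : Type u} {M : Type u} {A : Interp (constLang C) M}

theorem exists_level_of_true (h₁ : Sentence.True A (extSentence C))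
    (h₂ : Sentence.True A (wfSentence C)) (h₃ : Sentence.True A (fullSentence C)) :
    ∃ (β : Ordinal.{u}) (π : M ≃ VLevel β), ∀ a b, A.E a b ↔ (π a).1 ∈ (π b).1 := by
  rw [extSentence_true] at h₁
  rw [wfSentence_true] at h₂
  rw [fullSentence_true] at h₃
  refine exists_level (WellFounded.wellFounded_iff_has_min.2 ?_)
    (fun x y h => h₁ x y fun z => ⟨(h z).1, (h z).2⟩) ?_
  · rintro S ⟨x, hx⟩
    obtain ⟨m, hm, h⟩ := h₂ {p | p 0 ∈ S} x hx
    exact ⟨m, hm, fun y hy => h y hy⟩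
  · intro R S x hR hS
    obtain ⟨s, hs⟩ := h₃ {p | R (p 0) (p 1)} {p | S (p 0)} x hR hS
    exact ⟨s, fun t => ⟨(hs t).1, (hs t).2⟩⟩

/-- For fullness, ∈-induction shows that any simulation R satisfies rank y ≤ rank w whenever R y w.
A set S dominated by x thus has rank at most that of x and belongs to V_θ. -/
theorem true_of_level {θ : Ordinal.{u}} (e : M ≃ VLevel θ)
    (hE : ∀ a b, A.E a b ↔ (e a).1 ∈ (e b).1) :
    Sentence.True A (extSentence C) ∧ Sentence.True A (wfSentence C) ∧
      Sentence.True A (fullSentence C) := by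
  rw [extSentence_true, wfSentence_true, fullSentence_true]
  simp only [hE]
  refine ⟨fun x y h => e.injective (Subtype.ext (ZFSet.ext fun z => ?_)), fun S x hx => ?_,
    fun R S x hR hS => ?_⟩
  · constructor
    · intro hz
      have := (h (e.symm ⟨z, mem_level_of_mem hz (e x).2⟩)).1
      rw [e.apply_symm_apply] at this
      exact this hz
    · intro hz
      have := (h (e.symm ⟨z, mem_level_of_mem hz (e y).2⟩)).2
      rw [e.apply_symm_apply] at this
      exact this hz
  · have hwf : WellFounded fun a b : M => (e a).1 ∈ (e b).1 := InvImage.wf _ ZFSet.mem_wf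
    obtain ⟨m, hm, h⟩ := WellFounded.wellFounded_iff_has_min.1 hwf {a | ![a] ∈ S} ⟨x, hx⟩
    exact ⟨m, hm, fun y hy => h y hy⟩
  · have hrank : ∀ (z : ZFSet.{u}) (y w : M), (e y).1 = z → ![y, w] ∈ R →
        (e y).1.rank ≤ (e w).1.rank := by
      intro z
      induction z using ZFSet.inductionOn with
      | _ z ih =>
        rintro y w rfl hyw
        rw [rank_le_iff]
        intro t ht
        have ht' := mem_level_of_mem ht (e y).2
        obtain ⟨w', hw', h⟩ := hR y w hyw (e.symm ⟨t, ht'⟩) (by simpa using ht)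
        have := ih t ht _ _ (by simp) h
        rw [e.apply_symm_apply] at this
        exact this.trans_lt (rank_lt_of_mem hw')
    let s : ZFSet.{u} := ZFSet.sep (fun t => ∃ y, (e y).1 = t ∧ ![y] ∈ S) (vonNeumann θ)
    have hs : s ∈ vonNeumann θ := by
      rw [mem_vonNeumann]
      refine lt_of_le_of_lt ?_ (mem_vonNeumann.1 (e x).2)
      rw [rank_le_iff]
      intro t ht
      obtain ⟨-, y, rfl, hy⟩ := ZFSet.mem_sep.1 ht
      obtain ⟨z, hz, hyz⟩ := hS y hy
      exact (hrank _ _ _ rfl hyz).trans_lt (rank_lt_of_mem hz)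
    refine ⟨e.symm ⟨s, hs⟩, fun t => ?_⟩
    rw [e.apply_symm_apply]
    simp only [s, ZFSet.mem_sep]
    refine ⟨?_, fun h => ⟨(e t).2, t, rfl, h⟩⟩
    rintro ⟨-, y, hy, h⟩
    rwa [e.injective (Subtype.ext hy)] at h

end

/-! ### Embeddings from weak compactness -/

instance small_vLevel (θ : Ordinal.{u}) : Small.{u} (VLevel θ) :=
  inferInstanceAs (Small.{u} {x // x ∈ vonNeumann θ})

section

variable {C : Type u} {M : Type u} {A : Interp (constLang C) M} {θ : Ordinal.{u}}

theorem realize_toStructure (e : M ≃ VLevel θ) (hE : ∀ a b, A.E a b ↔ (e a).1 ∈ (e b).1)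
    {α : Type*} (φ : setLang.Formula α) (v : α → M) :
    @FirstOrder.Language.Formula.Realize setLang M A.toStructure α φ v ↔
      φ.Realize fun a => e (v a) := by
  let _ := A.toStructure
  let g : setLang.Equiv M (VLevel θ) :=
    { toEquiv := e
      map_fun' := fun f => Empty.elim f
      map_rel' := fun r x => by
        cases r with
        | mem => exact (hE _ _).symm }
  exact (FirstOrder.Language.StrongHomClass.realize_formula g φ).symm

theorem exists_formula_translation {α : Type u} (φ : setLang.Formula α) (c : α → C) :
    ∃ ψ : Sentence (constLang C), ψ.InL2 ℵ₀ ℵ₀ ∧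
      ∀ {M : Type u} (A : Interp (constLang C) M), Sentence.True A ψ ↔
        @FirstOrder.Language.Formula.Realize setLang M A.toStructure α φ fun a => A.c (c a) := by
  obtain ⟨ψ, h, h'⟩ := exists_translation φ
    (Γ := (PEmpty.elim : PEmpty.{u + 1} → Kind.{u})) (Sum.elim (fun a => cst (c a)) Fin.elim0)
  refine ⟨ψ, h, fun {M} A => (h' A _).trans (iff_of_eq ?_)⟩
  refine congrArg₂ (@FirstOrder.Language.BoundedFormula.Realize setLang M A.toStructure α 0 φ)
    (funext fun a => cst_val A (c a)) (Subsingleton.elim _ _)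

end

section

variable {κ : Cardinal.{u}}

/-- Every element of `a i` is one of the `a i'` with `i' < i`. -/
def boundSentence (a : Idx κ → Idx κ) (i : Idx κ) : Sentence (constLang (Option (Idx κ))) :=
  allF .ind (.neg (.conj fun o : Option (Set.Iio i) =>
    o.elim (elemF lastVar (cst (some (a i)))) fun i' => .neg (.eq lastVar (cst (some (a i'))))))

theorem boundSentence_true {M : Type u} (A : Interp (constLang (Option (Idx κ))) M)
    (a : Idx κ → Idx κ) (i : Idx κ) : Sentence.True A (boundSentence a i) ↔
      ∀ x, A.E x (A.c (some (a i))) → ∃ i' < i, x = A.c (some (a i')) := by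
  rw [Sentence.True, boundSentence, allF_holds]
  refine forall_congr' fun x => ?_
  simp only [Formula.Holds, Option.forall, Option.elim_none, Option.elim_some, elemF_holds,
    cst_val, lastVar_val]
  rw [not_and]
  refine imp_congr Iff.rfl ?_
  simp only [Subtype.forall, Set.mem_Iio, not_forall, not_not, exists_prop]
  rfl

theorem mk_Iio_lt (i : Idx κ) : #(Set.Iio i) < κ := by
  simpa using Cardinal.mk_Iio_lt i

/-- These sentences are why 𝕃_{κ,ω} is needed beside 𝕃²: the conjunction over the indices below i
may be infinite, but it is strictly first-order. -/
theorem boundSentence_inL2UnionL (hκ : ℵ₀ ≤ κ) (a : Idx κ → Idx κ) (i : Idx κ) :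
    (boundSentence a i).InL2UnionL κ := by
  refine Or.inr ⟨(allF_inL2 le_rfl).2 ⟨?_, ?_⟩, fun _ => rfl, ?_⟩
  · rw [Cardinal.mk_option]
    exact Cardinal.add_lt_of_lt hκ (mk_Iio_lt i) (Cardinal.one_lt_aleph0.trans_le hκ)
  · rintro (_ | i') <;> trivial
  · rintro (_ | i')
    · rintro ⟨k⟩
      refine ⟨rfl, ?_⟩
      fin_cases k
      · exact rfl
      · exact ⟨rfl, fun i => i.elim⟩
    · exact ⟨rfl, rfl, fun i => i.elim⟩

/-- The symbols are countable and the free variables number κ, so the diagram of a domain of size κ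
has at most κ sentences. -/
theorem mk_formula_le (hκ : ℵ₀ ≤ κ) : #(setLang.Formula (Idx κ)) ≤ κ := by
  have h : #(setLang.Formula (Idx κ)) ≤ #(Σ n, setLang.BoundedFormula (Idx κ) n) :=
    Cardinal.mk_le_of_injective (f := fun φ => ⟨0, φ⟩) fun _ _ h => eq_of_heq (Sigma.mk.inj h).2
  have hc : setLang.card ≤ ℵ₀ := by
    have h₁ : Countable (Σ n, setLang.Functions n) :=
      @Encodable.countable _ (@IsEmpty.toEncodable _ ⟨fun x => Empty.elim x.2⟩)
    have h₂ : Countable (Σ n, setLang.Relations n) := by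
      refine Function.Injective.countable (f := fun _ => ()) ?_
      rintro ⟨_, r⟩ ⟨_, r'⟩ _
      cases (r : MemSymb _)
      cases (r' : MemSymb _)
      rfl
    rw [FirstOrder.Language.card, Cardinal.mk_le_aleph0_iff]
    exact instCountableSum
  refine h.trans (FirstOrder.Language.BoundedFormula.card_le.trans (max_le hκ ?_))
  rw [Cardinal.lift_uzero, Cardinal.mk_ord_toType]
  refine Cardinal.add_le_of_le hκ le_rfl (le_trans ?_ hκ)
  exact Cardinal.lift_le_aleph0.2 hc

/-- A theory of size < κ is one of its own small subsets, so the exact size in the definition may be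
relaxed. -/
theorem WeaklyCompactForL2UnionL.of_le (h : WeaklyCompactForL2UnionL κ) {L : Language.{u}}
    (hL : L.ArityLT ℵ₀) {T : Set (Sentence L)} (hT : ∀ φ ∈ T, φ.InL2UnionL κ)
    (hcard : #T ≤ lift.{u + 1} κ) (hsat : SatisfiableLT κ T) : Satisfiable T :=
  hcard.lt_or_eq.elim (hsat T subset_rfl) fun he => h L hL T hT he hsat

/-- A model of T is a level V_β, and j sends x ∈ D to the value of its constant. The diagram makes j
elementary, and the constant `none` names a new element of j(κ). -/
theorem embeddingPropertyAt_of_weaklyCompact (hκ : ℵ₀ ≤ κ) (h : WeaklyCompactForL2UnionL κ)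
    (θ : Ordinal.{u}) : EmbeddingPropertyAt κ θ := by
  intro D hD hcard
  obtain ⟨e⟩ : Nonempty (Idx κ ≃ D) := by
    refine Cardinal.lift_mk_eq'.1 ?_
    rw [hcard, Cardinal.mk_ord_toType, Cardinal.lift_lift]
  have ha : ∀ i : Idx κ, ∃ a, (e a).1.1 = i.set := fun i => by
    obtain ⟨x, hx, he⟩ := hD i.toOrd i.toOrd.2.le
    exact ⟨e.symm ⟨x, hx⟩, by rw [e.apply_symm_apply]; exact he⟩
  choose a ha using ha
  obtain ⟨k, hk⟩ : ∃ k, (e k).1.1 = κ.ord.toZFSet := by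
    obtain ⟨x, hx, he⟩ := hD κ.ord le_rfl
    exact ⟨e.symm ⟨x, hx⟩, by simpa using he⟩
  choose tr tr_inL2 tr_true using fun φ : setLang.Formula (Idx κ) =>
    exists_formula_translation φ (some : Idx κ → Option (Idx κ))
  let ne : Idx κ → Sentence (constLang (Option (Idx κ))) := fun i =>
    .neg (.eq (cst none) (cst (some (a i))))
  have ne_true : ∀ {M : Type u} (A : Interp (constLang (Option (Idx κ))) M) i,
      Sentence.True A (ne i) ↔ A.c none ≠ A.c (some (a i)) := fun A i => by
    rw [Sentence.True, negF_holds, eqF_holds, cst_val, cst_val]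
    rfl
  let dk : Sentence (constLang (Option (Idx κ))) := elemF (cst none) (cst (some k))
  have dk_true : ∀ {M : Type u} (A : Interp (constLang (Option (Idx κ))) M),
      Sentence.True A dk ↔ A.E (A.c none) (A.c (some k)) := fun A => by
    rw [Sentence.True, elemF_holds, cst_val, cst_val]
  let T : Set (Sentence (constLang (Option (Idx κ)))) :=
    {extSentence _, wfSentence _, fullSentence _, dk} ∪ Set.range (boundSentence a) ∪
      tr '' {φ | φ.Realize fun i => (e i).1} ∪ Set.range ne
  obtain ⟨M, hM, A, hA⟩ : Satisfiable T := by
    refine h.of_le ⟨fun _ => ?_, fun _ => ?_⟩ ?_ ?_ ?_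
    · exact Cardinal.lt_aleph0_of_finite _
    · exact Cardinal.lt_aleph0_of_finite _
    · rintro φ ((((rfl | rfl | rfl | rfl) | ⟨i, rfl⟩) | ⟨φ, -, rfl⟩) | ⟨i, rfl⟩)
      · exact Or.inl extSentence_inL2
      · exact Or.inl wfSentence_inL2
      · exact Or.inl fullSentence_inL2
      · exact Or.inl trivial
      · exact boundSentence_inL2UnionL hκ a i
      · exact Or.inl (tr_inL2 φ)
      · exact Or.inl trivial
    · have hκ' : ℵ₀ ≤ lift.{u + 1} κ := by simpa using hκ
      have hr : ∀ {α : Type u} (f : α → Sentence (constLang (Option (Idx κ)))), #α ≤ κ →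
          #(Set.range f) ≤ lift.{u + 1} κ := fun f hf =>
        (Cardinal.lift_id'.{u, u + 1} _).symm.trans_le
          (Cardinal.mk_range_le_lift.trans (Cardinal.lift_le.2 hf))
      have hr' := fun f => hr (α := Idx κ) f (Cardinal.mk_ord_toType κ).le
      have htr : #(tr '' {φ | φ.Realize fun i => (e i).1}) ≤ lift.{u + 1} κ :=
        (Cardinal.mk_le_mk_of_subset (Set.image_subset_range _ _)).trans (hr _ (mk_formula_le hκ))
      refine (Cardinal.mk_union_le _ _).trans (Cardinal.add_le_of_le hκ' ?_ (hr' _))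
      refine (Cardinal.mk_union_le _ _).trans (Cardinal.add_le_of_le hκ' ?_ htr)
      refine (Cardinal.mk_union_le _ _).trans (Cardinal.add_le_of_le hκ' ?_ (hr' _))
      exact (Cardinal.lt_aleph0_of_finite _).le.trans hκ'
    · intro T₀ hT₀ hT₀c
      classical
      -- Since T₀ has fewer than κ sentences, f misses some i₀, and `none` is interpreted as that
      -- ordinal. The default k is arbitrary. Distinct indices are not assumed to give distinct
      -- sentences, so each one is verified at the index chosen by f.
      let f : T₀ → Idx κ := fun s => if hs : ∃ i, ne i = s then hs.choose else k
      obtain ⟨i₀, hi₀⟩ : ∃ i₀, ∀ s, f s ≠ i₀ := by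
        by_contra! hcon
        have := Cardinal.mk_le_of_surjective (f := fun s => ULift.up.{u + 1} (f s))
          (fun i => let ⟨s, hs⟩ := hcon i.down; ⟨s, congrArg ULift.up hs⟩)
        rw [Cardinal.mk_uLift, Cardinal.mk_ord_toType] at this
        exact hT₀c.not_ge this
      let eM : Shrink.{u} (VLevel θ) ≃ VLevel θ := (equivShrink _).symm
      let A : Interp (constLang (Option (Idx κ))) (Shrink.{u} (VLevel θ)) :=
        mkInterp (fun x y => (eM x).1 ∈ (eM y).1)
          fun o => eM.symm (o.elim (e (a i₀)).1 fun i => (e i).1)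
      have hE : ∀ x y, A.E x y ↔ (eM x).1 ∈ (eM y).1 := fun x y => Iff.rfl
      have hc : ∀ i, A.c (some i) = eM.symm (e i).1 := fun i => rfl
      have hd : A.c none = eM.symm (e (a i₀)).1 := rfl
      obtain ⟨h₁, h₂, h₃⟩ := true_of_level eM hE
      refine ⟨_, ⟨A.c none⟩, A, fun φ hφ => ?_⟩
      rcases hT₀ hφ with (((rfl | rfl | rfl | rfl) | ⟨i, rfl⟩) | ⟨φ, hr, rfl⟩) | ⟨i, rfl⟩
      · exact h₁
      · exact h₂
      · exact h₃
      · rw [dk_true, hE, hc, hd, eM.apply_symm_apply, eM.apply_symm_apply, ha, hk,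
          mem_toZFSet_ord]
        exact ⟨_, rfl⟩
      · rw [boundSentence_true]
        intro x hx
        rw [hE, hc, eM.apply_symm_apply, ha, Idx.mem_set] at hx
        obtain ⟨i', hi', hx⟩ := hx
        refine ⟨i', hi', ?_⟩
        rw [hc, Equiv.eq_symm_apply]
        exact Subtype.ext (hx.symm.trans (ha i').symm)
      · rw [tr_true, realize_toStructure eM hE]
        simp only [hc, eM.apply_symm_apply]
        exact hr
      · have hs : ∃ j, ne j = ((⟨ne i, hφ⟩ : T₀) : Sentence _) := ⟨i, rfl⟩
        have hf : f ⟨ne i, hφ⟩ = hs.choose := dif_pos hs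
        have hne : ne (f ⟨ne i, hφ⟩) = ne i := by rw [hf]; exact hs.choose_spec
        rw [← hne, ne_true, hd, hc]
        intro hcon
        have := congrArg Subtype.val (eM.symm.injective hcon)
        rw [ha, ha] at this
        exact hi₀ _ (Idx.set_injective this).symm
  have hext := hA _ (Or.inl (Or.inl (Or.inl (Or.inl rfl))))
  have hwf := hA _ (Or.inl (Or.inl (Or.inl (Or.inr (Or.inl rfl)))))
  have hfull := hA _ (Or.inl (Or.inl (Or.inl (Or.inr (Or.inr (Or.inl rfl))))))
  have hdk := (dk_true A).1 (hA _ (Or.inl (Or.inl (Or.inl (Or.inr (Or.inr (Or.inr rfl)))))))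
  have hbd := fun i => (boundSentence_true A a i).1 (hA _ (Or.inl (Or.inl (Or.inr ⟨i, rfl⟩))))
  have hne := fun i => (ne_true A i).1 (hA _ (Or.inr ⟨i, rfl⟩))
  obtain ⟨β, π, hπ⟩ := exists_level_of_true hext hwf hfull
  have htr : ∀ φ : setLang.Formula (Idx κ), (φ.Realize fun i => (e i).1) →
      φ.Realize fun i => π (A.c (some i)) := fun φ hφ => by
    rw [← realize_toStructure π hπ, ← tr_true]
    exact hA _ (Or.inl (Or.inr ⟨φ, hφ, rfl⟩))
  -- The diagram is closed under negation, so preservation upgrades to equivalence.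
  have htr' : ∀ φ : setLang.Formula (Idx κ), (φ.Realize fun i => (e i).1) ↔
      φ.Realize fun i => π (A.c (some i)) := fun φ => by
    refine ⟨htr φ, fun hφ => ?_⟩
    by_contra hcon
    exact FirstOrder.Language.Formula.realize_not.1
      (htr φ.not (FirstOrder.Language.Formula.realize_not.2 hcon)) hφ
  have hj : IsPartialElementary D fun x => π (A.c (some (e.symm x))) := by
    intro n φ x
    have := htr' (φ.relabel fun i => e.symm (x i))
    rw [FirstOrder.Language.Formula.realize_relabel,
      FirstOrder.Language.Formula.realize_relabel] at this
    simpa [Function.comp_def] using this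
  -- Induction on i: the bounding sentence admits no elements of j(i) beyond the earlier indices,
  -- and elementarity supplies all of these.
  have hfix : ∀ i, (π (A.c (some (a i)))).1 = i.set := by
    intro i
    induction i using WellFoundedLT.induction with
    | _ i ih =>
      refine ZFSet.ext fun z => ⟨fun hz => ?_, fun hz => ?_⟩
      · have hz' := mem_level_of_mem hz (π _).2
        obtain ⟨i', hi', he⟩ := hbd i (π.symm ⟨z, hz'⟩) (by rw [hπ]; simpa using hz)
        rw [Equiv.symm_apply_eq] at he
        have he' : z = i'.set := (congrArg Subtype.val he).trans (ih i' hi')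
        exact Idx.mem_set.2 ⟨i', hi', he'.symm⟩
      · obtain ⟨i', hi', rfl⟩ := Idx.mem_set.1 hz
        rw [← ih i' hi']
        have := (hj 2 (memFormula 0 1) ![e (a i'), e (a i)]).1
          ((realize_memFormula _ _ _).2 (by simpa [ha] using Idx.set_mem_set.2 hi'))
        rw [realize_memFormula] at this
        simpa using this
  refine ⟨β, _, hj, ⟨e k, hk, fun hcon => ?_⟩, ?_⟩
  · dsimp only at hcon
    rw [e.symm_apply_apply] at hcon
    rw [hπ, hcon, mem_toZFSet_ord] at hdk
    obtain ⟨i, hi⟩ := hdk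
    exact hne i (π.injective (Subtype.ext (hi.symm.trans (hfix i).symm)))
  · rintro δ ⟨x, hx, hjx⟩
    by_contra! hδ
    have hδ' : δ ∈ Set.Iio κ.ord := hδ
    rw [← Idx.set_mk hδ] at hx hjx
    have : x = e (a (Ordinal.ToType.mk ⟨δ, hδ'⟩)) :=
      Subtype.ext (Subtype.ext (hx.trans (ha _).symm))
    rw [this] at hjx
    dsimp only at hjx
    rw [e.symm_apply_apply] at hjx
    exact hjx (hfix _)

end

/-! ### The equivalences -/

theorem Formula.InL2.mono {lam lam' κ κ' : Cardinal.{u}} (hlam : lam ≤ lam') (hκ : κ ≤ κ')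
    {L : Language.{u}} {X : Type u} {Γ : X → Kind.{u}} {φ : Formula L Γ} (h : φ.InL2 lam κ) :
    φ.InL2 lam' κ' := by
  induction φ with
  | eq => trivial
  | mem => trivial
  | rel => trivial
  | neg φ ih => exact ih h
  | conj φ ih => exact ⟨h.1.trans_le hlam, fun i => ih i (h.2 i)⟩
  | all Δ φ ih => exact ⟨h.1.trans_le hκ, ih h.2⟩

variable {κ : Cardinal.{u}}

theorem WeaklyCompactForL2.l2UnionL (hκ : ℵ₀ ≤ κ) (h : WeaklyCompactForL2 κ) :
    WeaklyCompactForL2UnionL κ := fun L hL T hT hcard hsat =>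
  h L ⟨fun f => (hL.1 f).trans_le hκ, fun r => (hL.2 r).trans_le hκ⟩ T
    (fun φ hφ => (hT φ hφ).elim (fun h => h.mono hκ hκ) fun h => h.1.mono le_rfl hκ) hcard hsat

/-- Enumerating in the order type of the initial ordinal κ makes every proper initial segment a
small subset, to which <κ-satisfiability applies. -/
theorem exists_enumeration_of_mk_eq {α : Type (u + 1)} {T : Set α}
    (hT : #T = lift.{u + 1} κ) : ∃ φ : Idx κ → α, Set.range φ = T ∧
      ∀ i : Idx κ, φ '' Set.Iio i ⊆ T ∧ #(φ '' Set.Iio i) < lift.{u + 1} κ := by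
  obtain ⟨e⟩ : Nonempty (Idx κ ≃ T) := by
    refine Cardinal.lift_mk_eq'.1 ?_
    rw [hT, Cardinal.mk_ord_toType, Cardinal.lift_lift]
  refine ⟨fun i => (e i).1, ?_, fun i => ⟨?_, ?_⟩⟩
  · exact (e.surjective.range_comp _).trans Subtype.range_val
  · rintro _ ⟨i', -, rfl⟩
    exact (e i').2
  · refine lt_of_le_of_lt ?_ (Cardinal.lift_lt.2 (mk_Iio_lt i))
    exact (Cardinal.lift_id'.{u, u + 1} _).symm.trans_le Cardinal.mk_image_le_lift

theorem WeaklyCompactForL2UnionL.l2 [hκ : Fact (ℵ₀ < κ)] (h : WeaklyCompactForL2UnionL κ) :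
    WeaklyCompactForL2 κ := by
  intro L hL T hT hcard hsat
  obtain ⟨φ, rfl, hφ⟩ := exists_enumeration_of_mk_eq hcard
  have hsat' := fun i => hsat _ (hφ i).1 (hφ i).2
  choose M hM A hA using hsat'
  -- Embeddings are available at every level, so any μ above κ and the sizes of the chosen models
  -- will do; the Löwenheim–Skolem number is not needed.
  have hμ : κ < succ (κ ⊔ ⨆ i, #(M i)) := lt_succ_of_le le_sup_left
  refine satisfiable_of_embeddingPropertyAt hμ
    (embeddingPropertyAt_of_weaklyCompact hκ.out.le h _) hL (fun i => hT _ ⟨i, rfl⟩)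
    fun i => ⟨M i, hM i, A i, lt_succ_of_le ?_, fun i' hi' => hA i _ ⟨i', hi', rfl⟩⟩
  exact (le_ciSup Cardinal.bddAbove_of_small i).trans le_sup_right

theorem WeaklyCompactForL2.partialEmbeddingProperty (hκ : ℵ₀ ≤ κ) (h : WeaklyCompactForL2 κ) :
    PartialEmbeddingProperty κ :=
  embeddingPropertyAt_of_weaklyCompact hκ (h.l2UnionL hκ) _

/-- The infimum of the empty set is 0, so κ < ℓ²_κ guarantees that the defining set is nonempty; by
well-ordering the infimum is then attained. -/
theorem lsNumber_spec (h : κ < lsNumber κ) {L : Language.{u}} (hL : L.ArityLT κ) {φ : Sentence L}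
    (hφ : φ.InL2 κ κ) (hsat : Satisfiable {φ}) :
    ∃ (M : Type u) (_ : Nonempty M) (A : Interp L M), #M < lsNumber κ ∧ Sentence.True A φ := by
  have hmem : lsNumber κ ∈ {μ : Cardinal.{u} | ∀ (L : Language.{u}), L.ArityLT κ →
      ∀ φ : Sentence L, φ.InL2 κ κ → Satisfiable {φ} →
      ∃ (M : Type u) (_ : Nonempty M) (A : Interp L M), #M < μ ∧ Sentence.True A φ} := by
    refine csInf_mem (Set.nonempty_iff_ne_empty.2 fun hne => ?_)
    rw [lsNumber, hne, Cardinal.sInf_empty] at h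
    exact not_lt_bot h
  exact hmem L hL φ hφ hsat

theorem PartialEmbeddingProperty.weaklyCompactForL2 [Fact (ℵ₀ < κ)] (hlt : κ < lsNumber κ)
    (h : PartialEmbeddingProperty κ) : WeaklyCompactForL2 κ := by
  intro L hL T hT hcard hsat
  obtain ⟨φ, rfl, hφ⟩ := exists_enumeration_of_mk_eq hcard
  refine satisfiable_of_embeddingPropertyAt hlt h hL (fun i => hT _ ⟨i, rfl⟩) fun i => ?_
  obtain ⟨M, hM, A, hA⟩ := hsat _ (hφ i).1 (hφ i).2
  -- An initial segment has fewer than κ sentences, so its conjunction is one sentence of 𝕃²_{κ,κ}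
  -- and has a model of size below ℓ²_κ.
  obtain ⟨M', hM', A', hlt', hA'⟩ := lsNumber_spec hlt hL
    (φ := .conj fun i' : Set.Iio i => φ i') ⟨mk_Iio_lt i, fun i' => hT _ ⟨i', rfl⟩⟩
    ⟨M, hM, A, by
      rintro _ rfl
      exact fun i' => hA _ ⟨i', i'.2, rfl⟩⟩
  exact ⟨M', hM', A', hlt', fun i' hi' => hA' ⟨i', hi'⟩⟩

end SecondOrder

theorem mainTheorem8 (κ : Cardinal.{u}) (hκ : Cardinal.aleph0 < κ) :
    (SecondOrder.WeaklyCompactForL2UnionL κ ↔ SecondOrder.WeaklyCompactForL2 κ) ∧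
      (κ < SecondOrder.lsNumber κ →
        (SecondOrder.WeaklyCompactForL2 κ ↔ SecondOrder.PartialEmbeddingProperty κ)) := by
  have : Fact (Cardinal.aleph0 < κ) := ⟨hκ⟩
  exact ⟨⟨fun h => h.l2, fun h => h.l2UnionL hκ.le⟩, fun hlt =>
    ⟨fun h => h.partialEmbeddingProperty hκ.le, fun h => h.weaklyCompactForL2 hlt⟩⟩
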